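/- Let $\lambda>0$ and $\Lambda>0$. Let $\mathrm{sn}(u,i)$ be Jacobi's elliptic sine of modulus $k=i$, i.e. $\mathrm{sn}(u,i)=\sin\varphi$ where $u=\int_0^{\varphi}\frac{d\vartheta}{\sqrt{1+\sin^2\vartheta}}$, let $K(i)=\int_0^{\pi/2}\frac{d\vartheta}{\sqrt{1+\sin^2\vartheta}}$, let $\theta$ be the Heaviside function and $$G(t)=\Lambda\,\theta(t)\Big(\frac{2}{\lambda}\Big)^{1/4}\mathrm{sn}\Big[\Big(\frac{\lambda}{2}\Big)^{1/4}\Lambda t,\,i\Big],\qquad \omega_n=\Big(n+\tfrac12\Big)\frac{\pi}{K(i)}\Big(\frac{\lambda}{2}\Big)^{1/4}\Lambda,$$ $$B_n=(2n+1)\frac{\pi^2}{K(i)^2}\,\frac{(-1)^{n+1}e^{-(n+\frac12)\pi}}{1+e^{-(2n+1)\pi}}\qquad(n=0,1,2,\dots).$$ 1. (Propagator.) In units of time with $\Lambda=1$, $G$ solves $\partial_t^2G+\lambda G^3=\delta$ in the sense of distributions on $\mathbb R$. For general $\Lambda$, $G(t)=\Lambda\,G|_{\Lambda=1}(\Lambda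 t)$ and $\partial_t^2G+\lambda G^3=\Lambda^2\delta$; $G$ vanishes for $t<0$ and is, up to null sets, the only solution $H$ (with $H,H^3$ locally integrable) of this equation that vanishes for $t<0$. The function $G(-t)$ solves the same equation and is, up to null sets, the only such solution that vanishes for $t>0$ (the backward-propagating one). 2. (Fourier series.) For all real $u$, $$\mathrm{sn}(u,i)=\frac{2\pi}{K(i)}\sum_{n=0}^\infty\frac{(-1)^ne^{-(n+\frac12)\pi}}{1+e^{-(2n+1)\pi}}\sin\Big[(2n+1)\frac{\pi u}{2K(i)}\Big].$$ 3. (Fourier transform, kernel $e^{i\omega t}$.) For real $\omega$ and $\varepsilon>0$ the function $G(t)e^{i(\omega+i\varepsilon)t}$ is integrable and $\int G(t)e^{i(\omega+i\varepsilon)t}\,dt=\Lambda^2\sum_n\frac{B_n}{(\omega+i\varepsilon)^2-\omega_n^2}$; as $\varepsilon\to0^+$ the right-hand side converges, as a tempered distribution in $\omega$, to the Fourier transform of $G$. Further, $\Lambda^2\sum_n\frac{B_n}{\omega^2-\omega_n^2+i\varepsilon}$ is a convergent series for all real $\omega$ and $\varepsilon>0$, and as $\varepsilon\to0^+$ it converges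 to the Fourier transform of $G(t)$ when tested on Schwartz functions supported in $(-\omega_0,\infty)$, and to the Fourier transform of $G(-t)$ when tested on Schwartz functions supported in $(-\infty,\omega_0)$. 4. (Corrections at low frequency.) The function $\hat G(\omega)=\Lambda^2\sum_n\frac{B_n}{\omega^2-\omega_n^2}$ is smooth on $(-\omega_0,\omega_0)$. For every $n\ge0$ the Fourier transform of the kernel $t^nG(t)$ is there the function $(-i)^n\hat G^{(n)}(\omega)$, and as $\omega\to0$ one has $\hat G^{(n)}(\omega)\to\hat G^{(n)}(0)=(2/\lambda)^{(n+2)/4}\,\hat G^{(n)}(0)|_{\lambda=2}$. In particular the first correction, $a_4\,\hat G^{(4)}(\omega)$ with $a_4=\lambda\Lambda^4/20$ (that is, $\lambda/20$ when $\Lambda=1$), contributes at $\omega\to0$ only a constant: it equals $C+O(\omega^2)$ with $C=-\frac65\lambda\Lambda^6\sum_nB_n/\omega_n^6$ (an absolutely convergent series), and $C\to0$ as $\lambda\to\infty$ with $\Lambda$ fixed. (The leading term $\hat G(0)$ is itself of order $\lambda^{-1/2}$; no claim is made about the size of $C$ relative to it.) -/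

import Mathlib

open MeasureTheory Filter Topology Asymptotics
open scoped SchwartzMap

noncomputable section

namespace QuarticPropagator

/-- Incomplete elliptic integral of the first kind `F(φ | m)`, where the parameter
`m = k²` is the square of the modulus `k`. -/
def ellipticF (m φ : ℝ) : ℝ :=
  ∫ θ in (0 : ℝ)..φ, 1 / √(1 - m * Real.sin θ ^ 2)

/-- Complete elliptic integral of the first kind, parameter `m = k²`. -/
def ellipticK (m : ℝ) : ℝ := ellipticF m (Real.pi / 2)

/-- For `m < 1` the map `F(· | m)` is a bijection of the real line, so that its inverse
(the Jacobi amplitude, defined next) is a genuine inverse. -/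
theorem ellipticF_bijective {m : ℝ} (hm : m < 1) : Function.Bijective (ellipticF m) := by
  have hpos : ∀ θ : ℝ, 0 < 1 - m * Real.sin θ ^ 2 := fun θ => by
    have h1 : Real.sin θ ^ 2 ≤ 1 := Real.sin_sq_le_one θ
    rcases le_or_gt m 0 with h | h
    · nlinarith [sq_nonneg (Real.sin θ)]
    · nlinarith [sq_nonneg (Real.sin θ)]
  have hcont : Continuous fun θ : ℝ => 1 / √(1 - m * Real.sin θ ^ 2) := by
    refine continuous_const.div (by fun_prop) fun θ => (Real.sqrt_pos.2 (hpos θ)).ne'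
  have hder : ∀ x, HasDerivAt (ellipticF m) (1 / √(1 - m * Real.sin x ^ 2)) x := fun x =>
    intervalIntegral.integral_hasDerivAt_right (hcont.intervalIntegrable _ _)
      (hcont.stronglyMeasurableAtFilter _ _) hcont.continuousAt
  set c : ℝ := 1 / √(1 + |m|) with hc
  have hc0 : 0 < c := by positivity
  have hlow : ∀ θ : ℝ, c ≤ 1 / √(1 - m * Real.sin θ ^ 2) := fun θ => by
    refine one_div_le_one_div_of_le (Real.sqrt_pos.2 (hpos θ)) (Real.sqrt_le_sqrt ?_)
    have h1 : Real.sin θ ^ 2 ≤ 1 := Real.sin_sq_le_one θ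
    nlinarith [neg_abs_le m, abs_nonneg m, sq_nonneg (Real.sin θ)]
  have hmono : Monotone fun x => ellipticF m x - c * x := by
    refine monotone_of_deriv_nonneg
      (fun x => ((hder x).sub ((hasDerivAt_id x).const_mul c)).differentiableAt) fun x => ?_
    have := ((hder x).sub ((hasDerivAt_id x).const_mul c)).deriv
    have h2 : deriv (fun x => ellipticF m x - c * x) x
        = 1 / √(1 - m * Real.sin x ^ 2) - c * 1 := this
    rw [h2]
    linarith [hlow x]
  have h0 : ellipticF m 0 = 0 := by simp [ellipticF]
  have hF : Continuous (ellipticF m) :=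
    continuous_iff_continuousAt.2 fun x => (hder x).continuousAt
  constructor
  · refine StrictMono.injective fun x y hxy => ?_
    have := hmono hxy.le
    simp only at this
    nlinarith
  · refine hF.surjective ?_ ?_
    · refine tendsto_atTop_mono' _ ?_ (tendsto_id.const_mul_atTop hc0)
      filter_upwards [eventually_ge_atTop 0] with x hx
      have := hmono hx
      simp only [h0] at this
      simp only [id]
      linarith
    · refine tendsto_atBot_mono' _ ?_ (tendsto_id.const_mul_atBot hc0)
      filter_upwards [eventually_le_atBot 0] with x hx
      have := hmono hx
      simp only [h0] at this
      simp only [id]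
      linarith

/-- Jacobi amplitude: the inverse function of `F(· | m)` (for `m < 1`). -/
def jacobiAm (m u : ℝ) : ℝ := Function.invFun (ellipticF m) u

/-- Jacobi's `sn(u | m) = sin (am (u | m))`, with parameter `m = k²`. -/
def jacobiSn (m u : ℝ) : ℝ := Real.sin (jacobiAm m u)

/-- `sn(u, i)`: modulus `k = i`, that is, parameter `k² = -1`. -/
def snI (u : ℝ) : ℝ := jacobiSn (-1) u

/-- `K(i) = ∫₀^{π/2} dθ / √(1 + sin² θ)`. -/
def KI : ℝ := ellipticK (-1)

/-- Heaviside step function. -/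
def heaviside (t : ℝ) : ℝ := if 0 ≤ t then 1 else 0

/-- `G(t) = Λ θ(t) (2/λ)^{1/4} sn((λ/2)^{1/4} Λ t, i)`. -/
def propagator (lam Lam t : ℝ) : ℝ :=
  Lam * heaviside t * (2 / lam) ^ (1 / 4 : ℝ) * snI ((lam / 2) ^ (1 / 4 : ℝ) * Lam * t)

/-- `H` solves `∂ₜ² H + V'(H) = c δ` in the sense of distributions on the real line,
where `dV` is the function `V'` and `δ` is the Dirac distribution at `0`. -/
structure IsGreenFunction (dV : ℝ → ℝ) (c : ℝ) (H : ℝ → ℝ) : Prop where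
  locallyIntegrable : LocallyIntegrable H
  locallyIntegrable_comp : LocallyIntegrable fun t => dV (H t)
  equation : ∀ φ : ℝ → ℝ, ContDiff ℝ ((⊤ : ℕ∞) : WithTop ℕ∞) φ → HasCompactSupport φ →
    (∫ t, H t * iteratedDeriv 2 φ t) + (∫ t, dV (H t) * φ t) = c * φ 0

/-- Coefficients of the sine series of `sn(·, i)`. -/
def snCoeff (n : ℕ) : ℝ :=
  2 * Real.pi / KI * ((-1) ^ n * Real.exp (-((n + 1 / 2) * Real.pi))
    / (1 + Real.exp (-((2 * n + 1) * Real.pi))))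

/-- The residue coefficients `B_n`. -/
def residueB (n : ℕ) : ℝ :=
  (2 * n + 1) * (Real.pi ^ 2 / KI ^ 2) *
    ((-1) ^ (n + 1) * Real.exp (-((n + 1 / 2) * Real.pi))
      / (1 + Real.exp (-((2 * n + 1) * Real.pi))))

/-- The frequencies `ω_n = (n + 1/2) (π / K(i)) (λ/2)^{1/4} Λ`. -/
def freq (lam Lam : ℝ) (n : ℕ) : ℝ :=
  (n + 1 / 2) * (Real.pi / KI) * (lam / 2) ^ (1 / 4 : ℝ) * Lam

/-- The `n`-th summand `B_n / (w - ω_n²)`; here `w` is `ω² + iε`, `(ω + iε)²` or `ω²`. -/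
def poleTerm (lam Lam : ℝ) (w : ℂ) (n : ℕ) : ℂ :=
  (residueB n : ℂ) / (w - (freq lam Lam n : ℂ) ^ 2)

/-- `∑_n B_n / (w - ω_n²)`. -/
def poleSum (lam Lam : ℝ) (w : ℂ) : ℂ := ∑' n, poleTerm lam Lam w n

/-- The Fourier transform of `f`, with kernel `e^{iωt}`, as a tempered distribution in `ω`:
`⟨f̂, ψ⟩ = ∫ f(t) (∫ e^{iωt} ψ(ω) dω) dt`. -/
def fourierPairing (f : ℝ → ℝ) (ψ : 𝓢(ℝ, ℂ)) : ℂ :=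
  ∫ t, (f t : ℂ) * ∫ ω : ℝ, Complex.exp (Complex.I * ω * t) * ψ ω

/-- The transformed propagator on the real axis away from its poles:
`Λ² ∑_n B_n / (ω² - ω_n²)`. -/
def propagatorHat (lam Lam ω : ℝ) : ℂ := (Lam : ℂ) ^ 2 * poleSum lam Lam ((ω : ℂ) ^ 2)

/-- The first correction in frequency space, `a₄ d⁴Ĝ/dω⁴`, with `a₄ = λ/20` in units of
time in which `Λ = 1`, hence `a₄ = λ Λ⁴ / 20` in general. -/
def firstCorrection (lam Lam ω : ℝ) : ℂ :=
  ((lam * Lam ^ 4 / 20 : ℝ) : ℂ) * iteratedDeriv 4 (propagatorHat lam Lam) ω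

/-- The constant `-(6/5) λ Λ⁶ ∑_n B_n / ω_n⁶`. -/
def correctionConst (lam Lam : ℝ) : ℝ :=
  -(6 / 5) * lam * Lam ^ 6 * ∑' n, residueB n / freq lam Lam n ^ 6

end QuarticPropagator

end

open QuarticPropagator

open MeasureTheory Filter Topology Asymptotics
open scoped SchwartzMap

noncomputable section

namespace QuarticPropagator

/-! For modulus `i` the function sn is the lemniscate sine: it satisfies `sn'² = 1 - sn⁴` and `sn''
= -2 sn³`. With `s = (λ/2)^{1/4}`, so that `λ = 2 s⁴`, the function `(Λ/s) sn(sΛt)` solves `g'' + λ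
g³ = 0` with `g(0) = 0` and `g'(0) = Λ²`. Cutting it off at `t = 0` produces exactly the source `Λ²
δ`. Conversely, a solution vanishing for `t < 0` satisfies a twice integrated equation almost
everywhere (`IsGreenFunction.ae_eq_integral`), and a Grönwall argument makes its solution unique
(`eq_of_integral_equation`). Time reversal gives the backward statements.

The Fourier series comes from a contour shift carried out with real functions. The real part of
`sn(x + iy)` is `reSn x y`, its imaginary part `reSn y x`. By the Cauchy-Riemann equations, the sine
integral of the real part over `[0, K]` at height `y` is its value at height 0 times `cosh(κy)`,
provided `cos(κK) = 0` (`integral_reSn_sin`). As `y → K` the pole at `K + iK` makes the real part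
concentrate at `x = K` with mass `π/2` (`tendsto_integral_reSn_sin`). Comparing the two gives the
coefficients as hyperbolic secants; their absolute summability gives pointwise convergence.

Everything about the transform is termwise, since the coefficients decay exponentially. For `ω +
iε`, each sine has an elementary half-line transform, and Fubini with dominated convergence gives
the distributional limit. For `ω² + iε`, each pole is the transform of `-i/(2c) exp(-ic|t|)` with
`c² = ω_n² - iε` and `Im c < 0`. In the limit this kernel is the retarded sine kernel plus a
multiple of `exp(iω_n t)`, which sees only `ψ(-ω_n)`; this vanishes for tests supported in `(-ω_0,
∞)` (`integral_orderedKernel_ofReal`). The other half follows because the sum is even in `ω`.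

Inside `(-ω_0, ω_0)` the pole series is analytic, and a factor `t` in the kernel becomes `-i d/dω`
of the transform. The dependence on `λ` is a rescaling of frequency by `s`, and the first correction
is read off from the Taylor expansion of order four at `ω = 0`. -/

/-! ### The lemniscatic sine `sn(·, i)`: differential equation and symmetries -/

theorem one_add_sin_sq_pos (x : ℝ) : 0 < 1 + Real.sin x ^ 2 := by positivity

theorem ellipticF_neg_one (φ : ℝ) :
    ellipticF (-1) φ = ∫ θ in (0 : ℝ)..φ, 1 / √(1 + Real.sin θ ^ 2) := by
  simp [ellipticF]

theorem continuous_ellipticIntegrand :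
    Continuous fun θ : ℝ => 1 / √(1 + Real.sin θ ^ 2) :=
  continuous_const.div (by fun_prop) fun θ => (Real.sqrt_pos.2 (one_add_sin_sq_pos θ)).ne'

theorem hasDerivAt_ellipticF (x : ℝ) :
    HasDerivAt (ellipticF (-1)) (1 / √(1 + Real.sin x ^ 2)) x := by
  have h := continuous_ellipticIntegrand
  rw [show ellipticF (-1) = fun φ => ∫ θ in (0 : ℝ)..φ, 1 / √(1 + Real.sin θ ^ 2) from
    funext ellipticF_neg_one]
  exact intervalIntegral.integral_hasDerivAt_right (h.intervalIntegrable _ _)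
      (h.stronglyMeasurableAtFilter _ _) h.continuousAt

theorem strictMono_ellipticF : StrictMono (ellipticF (-1)) := by
  refine strictMono_of_deriv_pos fun x => ?_
  rw [(hasDerivAt_ellipticF x).deriv]
  have := Real.sqrt_pos.2 (one_add_sin_sq_pos x)
  positivity

theorem bijective_ellipticF : Function.Bijective (ellipticF (-1)) :=
  ellipticF_bijective (by norm_num)

theorem ellipticF_am (u : ℝ) : ellipticF (-1) (jacobiAm (-1) u) = u :=
  Function.rightInverse_invFun bijective_ellipticF.2 u

theorem am_ellipticF (x : ℝ) : jacobiAm (-1) (ellipticF (-1) x) = x :=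
  Function.leftInverse_invFun bijective_ellipticF.1 x

theorem am_eq_of_ellipticF_eq {x u : ℝ} (h : ellipticF (-1) x = u) : jacobiAm (-1) u = x := by
  rw [← h, am_ellipticF]

theorem strictMono_am : StrictMono (jacobiAm (-1)) := fun a b h => by
  rw [← strictMono_ellipticF.lt_iff_lt, ellipticF_am, ellipticF_am]
  exact h

theorem continuous_am : Continuous (jacobiAm (-1)) := by
  refine strictMono_am.monotone.continuous_of_surjective fun x => ⟨_, am_ellipticF x⟩

theorem hasDerivAt_am (u : ℝ) :
    HasDerivAt (jacobiAm (-1)) √(1 + Real.sin (jacobiAm (-1) u) ^ 2) u := by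
  have hp := Real.sqrt_pos.2 (one_add_sin_sq_pos (jacobiAm (-1) u))
  have := HasDerivAt.of_local_left_inverse (f := ellipticF (-1)) (g := jacobiAm (-1)) (a := u)
    continuous_am.continuousAt (hasDerivAt_ellipticF _) (by positivity)
    (Eventually.of_forall ellipticF_am)
  simpa using this

theorem ellipticF_neg (x : ℝ) : ellipticF (-1) (-x) = -ellipticF (-1) x := by
  rw [ellipticF_neg_one, ellipticF_neg_one]
  have := intervalIntegral.integral_comp_neg (a := 0) (b := x)
    (fun θ : ℝ => 1 / √(1 + Real.sin θ ^ 2))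
  simp only [Real.sin_neg, neg_sq, neg_zero] at this
  rw [this, intervalIntegral.integral_symm]

/-- The integrand is invariant under `θ ↦ π - θ`, so the sum of the two values has derivative zero;
`x = π/2` fixes the constant. -/
theorem ellipticF_pi_sub (x : ℝ) : ellipticF (-1) (Real.pi - x) = 2 * KI - ellipticF (-1) x := by
  have hd : ∀ y, HasDerivAt (fun y => ellipticF (-1) (Real.pi - y) + ellipticF (-1) y) 0 y := by
    intro y
    have h1 := (hasDerivAt_ellipticF (Real.pi - y)).comp y
      ((hasDerivAt_const y Real.pi).sub (hasDerivAt_id y))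
    refine (h1.add (hasDerivAt_ellipticF y)).congr_deriv ?_
    simp [Real.sin_pi_sub]
  have h := is_const_of_deriv_eq_zero (fun y => (hd y).differentiableAt)
    (fun y => (hd y).deriv) x (Real.pi / 2)
  simp only [sub_half] at h
  have : KI = ellipticF (-1) (Real.pi / 2) := rfl
  linarith

theorem ellipticF_zero : ellipticF (-1) 0 = 0 := by simp [ellipticF]

theorem KI_pos : 0 < KI := by
  rw [← ellipticF_zero]
  exact strictMono_ellipticF (by positivity)

theorem am_zero : jacobiAm (-1) 0 = 0 := am_eq_of_ellipticF_eq ellipticF_zero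

theorem am_KI : jacobiAm (-1) KI = Real.pi / 2 := am_eq_of_ellipticF_eq rfl

theorem am_neg (u : ℝ) : jacobiAm (-1) (-u) = -jacobiAm (-1) u :=
  am_eq_of_ellipticF_eq (by rw [ellipticF_neg, ellipticF_am])

theorem am_two_KI_sub (u : ℝ) : jacobiAm (-1) (2 * KI - u) = Real.pi - jacobiAm (-1) u :=
  am_eq_of_ellipticF_eq (by rw [ellipticF_pi_sub, ellipticF_am])

/-- The derivative of `sn(·, i)`. -/
def snDeriv (u : ℝ) : ℝ :=
  Real.cos (jacobiAm (-1) u) * √(1 + Real.sin (jacobiAm (-1) u) ^ 2)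

theorem hasDerivAt_snI (u : ℝ) : HasDerivAt snI (snDeriv u) u :=
  (Real.hasDerivAt_sin _).comp u (hasDerivAt_am u)

/-- Since `am' = √(1 + sin² am)`, the product rule gives `-s(1 + s²) + s(1 - s²)` with `s = sn u`.
-/
theorem hasDerivAt_snDeriv (u : ℝ) : HasDerivAt snDeriv (-2 * snI u ^ 3) u := by
  have hp := one_add_sin_sq_pos (jacobiAm (-1) u)
  have hs := Real.sqrt_pos.2 hp
  have ham := hasDerivAt_am u
  have h1 := (Real.hasDerivAt_cos _).comp u ham
  have h2 := ((((Real.hasDerivAt_sin _).comp u ham).pow 2).const_add 1).sqrt hp.ne'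
  refine (h1.mul h2).congr_deriv ?_
  simp only [snI, jacobiSn, Function.comp_apply, Pi.pow_apply]
  have hc : Real.cos (jacobiAm (-1) u) ^ 2 = 1 - Real.sin (jacobiAm (-1) u) ^ 2 :=
    Real.cos_sq' _
  have hq := Real.sq_sqrt hp.le
  field_simp
  simp only [Nat.cast_ofNat, Nat.reduceSub, pow_one]
  generalize √(1 + Real.sin (jacobiAm (-1) u) ^ 2) = q at *
  generalize Real.sin (jacobiAm (-1) u) = s at *
  generalize Real.cos (jacobiAm (-1) u) = c at *
  rw [hc, hq]
  ring

theorem snDeriv_sq (u : ℝ) : snDeriv u ^ 2 = 1 - snI u ^ 4 := by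
  rw [snDeriv, mul_pow, Real.sq_sqrt (one_add_sin_sq_pos _).le, Real.cos_sq']
  simp only [snI, jacobiSn]
  ring

theorem snI_zero : snI 0 = 0 := by simp [snI, jacobiSn, am_zero]

theorem snDeriv_zero : snDeriv 0 = 1 := by simp [snDeriv, am_zero]

theorem snI_KI : snI KI = 1 := by simp [snI, jacobiSn, am_KI]

theorem snDeriv_KI : snDeriv KI = 0 := by simp [snDeriv, am_KI]

theorem snI_neg (u : ℝ) : snI (-u) = -snI u := by simp [snI, jacobiSn, am_neg]

theorem snI_two_KI_sub (u : ℝ) : snI (2 * KI - u) = snI u := by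
  simp [snI, jacobiSn, am_two_KI_sub, Real.sin_pi_sub]

theorem snI_add_four_KI (u : ℝ) : snI (u + 4 * KI) = snI u := by
  rw [← snI_two_KI_sub, show 2 * KI - (u + 4 * KI) = -(2 * KI + u) by ring, snI_neg,
    ← snI_two_KI_sub, show 2 * KI - (2 * KI + u) = -u by ring, snI_neg, neg_neg]

theorem abs_snI_le_one (u : ℝ) : |snI u| ≤ 1 := Real.abs_sin_le_one _

theorem continuous_snI : Continuous snI :=
  continuous_iff_continuousAt.2 fun u => (hasDerivAt_snI u).continuousAt

theorem continuous_snDeriv : Continuous snDeriv :=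
  continuous_iff_continuousAt.2 fun u => (hasDerivAt_snDeriv u).continuousAt

theorem am_mem_Icc {u : ℝ} (hu : u ∈ Set.Icc 0 KI) :
    jacobiAm (-1) u ∈ Set.Icc 0 (Real.pi / 2) := by
  rw [← am_zero, ← am_KI]
  exact ⟨strictMono_am.monotone hu.1, strictMono_am.monotone hu.2⟩

theorem snI_nonneg {u : ℝ} (hu : u ∈ Set.Icc 0 KI) : 0 ≤ snI u :=
  Real.sin_nonneg_of_nonneg_of_le_pi (am_mem_Icc hu).1
    ((am_mem_Icc hu).2.trans (by linarith [Real.pi_pos]))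

theorem snDeriv_pos {u : ℝ} (hu : u ∈ Set.Ico 0 KI) : 0 < snDeriv u := by
  have h1 := (am_mem_Icc ⟨hu.1, hu.2.le⟩).1
  have h2 : jacobiAm (-1) u < Real.pi / 2 := am_KI ▸ strictMono_am hu.2
  exact mul_pos (Real.cos_pos_of_mem_Ioo ⟨by linarith [Real.pi_pos], h2⟩)
    (Real.sqrt_pos.2 (one_add_sin_sq_pos _))

theorem snDeriv_nonneg {u : ℝ} (hu : u ∈ Set.Icc 0 KI) : 0 ≤ snDeriv u := by
  rcases hu.2.lt_or_eq with h | h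
  · exact (snDeriv_pos ⟨hu.1, h⟩).le
  · rw [h, snDeriv_KI]

theorem strictMonoOn_snI : StrictMonoOn snI (Set.Icc 0 KI) := by
  intro a ha b hb hab
  have h1 := am_mem_Icc ha
  have h2 := am_mem_Icc hb
  refine Real.strictMonoOn_sin ⟨?_, h1.2⟩ ⟨?_, h2.2⟩ (strictMono_am hab) <;>
    linarith [h1.1, h2.1, Real.pi_pos]

/-! ### `sn` at complex argument, through its real part -/

/-- The dominating function is a constant: the derivative is continuous, hence bounded, on the
compact product of `[a, b]` with a closed ball around `y₀`. -/
theorem hasDerivAt_intervalIntegral_of_continuousOn {f f' : ℝ → ℝ → ℝ} {a b y₀ : ℝ}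
    (hab : a ≤ b) {U : Set ℝ} (hU : IsOpen U) (hy₀ : y₀ ∈ U)
    (hf : ∀ x ∈ Set.Icc a b, ∀ y ∈ U, HasDerivAt (f x) (f' x y) y)
    (hc : ∀ y ∈ U, ContinuousOn (fun x => f x y) (Set.Icc a b))
    (hc' : ContinuousOn (Function.uncurry f') (Set.Icc a b ×ˢ U)) :
    HasDerivAt (fun y => ∫ x in a..b, f x y) (∫ x in a..b, f' x y₀) y₀ := by
  obtain ⟨r, hr, hrU⟩ := Metric.nhds_basis_closedBall.mem_iff.1 (hU.mem_nhds hy₀)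
  obtain ⟨C, hC⟩ := (isCompact_Icc.prod (isCompact_closedBall y₀ r)).exists_bound_of_continuousOn
    (hc'.mono (Set.prod_mono le_rfl hrU))
  have hsub : Set.uIoc a b ⊆ Set.Icc a b := by
    rw [Set.uIoc_of_le hab]; exact Set.Ioc_subset_Icc_self
  have hmeas : ∀ g : ℝ → ℝ, ContinuousOn g (Set.Icc a b) →
      AEStronglyMeasurable g (volume.restrict (Set.uIoc a b)) := fun g hg =>
    (hg.mono hsub).aestronglyMeasurable measurableSet_uIoc
  refine (intervalIntegral.hasDerivAt_integral_of_dominated_loc_of_deriv_le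
    (F := fun y x => f x y) (F' := fun y x => f' x y) (bound := fun _ => C)
    (Metric.closedBall_mem_nhds y₀ hr) ?_ ?_ ?_ ?_ ?_ ?_).2
  · filter_upwards [hU.mem_nhds hy₀] with y hy using hmeas _ (hc y hy)
  · exact ((hc y₀ hy₀).mono (by rw [Set.uIcc_of_le hab])).intervalIntegrable
  · refine hmeas _ (hc'.comp (f := fun x => (x, y₀)) (by fun_prop) fun x hx => ⟨hx, hy₀⟩)
  · exact Eventually.of_forall fun x hx y hy => hC (x, y) ⟨hsub hx, hy⟩
  · exact intervalIntegrable_const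
  · exact Eventually.of_forall fun x hx y hy => hf x (hsub hx) y (hrU hy)

theorem snI_sq_le_one (x : ℝ) : snI x ^ 2 ≤ 1 := (sq_le_one_iff_abs_le_one _).2 (abs_snI_le_one x)

theorem snI_sq_lt_one {y : ℝ} (hy : y ∈ Set.Ioo (-KI) KI) : snI y ^ 2 < 1 := by
  have key : ∀ z ∈ Set.Ico 0 KI, snI z ^ 2 < 1 := fun z hz => by
    have hz' : z ∈ Set.Icc 0 KI := ⟨hz.1, hz.2.le⟩
    have := strictMonoOn_snI hz' ⟨KI_pos.le, le_rfl⟩ hz.2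
    rw [snI_KI] at this
    nlinarith [snI_nonneg hz']
  rcases le_total 0 y with h | h
  · exact key y ⟨h, hy.2⟩
  · have := key (-y) ⟨by linarith, by linarith [hy.1]⟩
    rwa [snI_neg, neg_sq] at this

theorem one_sub_snI_sq_mul_pos (x : ℝ) {y : ℝ} (hy : y ∈ Set.Ioo (-KI) KI) :
    0 < 1 - snI x ^ 2 * snI y ^ 2 := by
  nlinarith [snI_sq_le_one x, snI_sq_lt_one hy, sq_nonneg (snI y), sq_nonneg (snI x)]

/-- The real part of `sn(x + iy, i)`; its imaginary part is `reSn y x`. -/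
def reSn (x y : ℝ) : ℝ := snI x * snDeriv y / (1 - snI x ^ 2 * snI y ^ 2)

/-- The partial derivative of `reSn` in its first argument. -/
def reSnFst (x y : ℝ) : ℝ :=
  snDeriv x * snDeriv y * (1 + snI x ^ 2 * snI y ^ 2) / (1 - snI x ^ 2 * snI y ^ 2) ^ 2

/-- The partial derivative of `reSn` in its second argument. -/
def reSnSnd (x y : ℝ) : ℝ :=
  2 * snI x * snI y * (snI x ^ 2 - snI y ^ 2) / (1 - snI x ^ 2 * snI y ^ 2) ^ 2

theorem hasDerivAt_reSn_fst {x y : ℝ} (h : 1 - snI x ^ 2 * snI y ^ 2 ≠ 0) :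
    HasDerivAt (fun x => reSn x y) (reSnFst x y) x := by
  have h1 := (hasDerivAt_snI x).mul_const (snDeriv y)
  have h2 := (((hasDerivAt_snI x).pow 2).mul_const (snI y ^ 2)).const_sub 1
  refine (h1.div h2 h).congr_deriv ?_
  simp only [reSnFst, Pi.pow_apply]
  congr 1
  push_cast
  ring

theorem hasDerivAt_reSn_snd {x y : ℝ} (h : 1 - snI x ^ 2 * snI y ^ 2 ≠ 0) :
    HasDerivAt (fun y => reSn x y) (reSnSnd x y) y := by
  have h1 := (hasDerivAt_snDeriv y).const_mul (snI x)
  have h2 := (((hasDerivAt_snI y).pow 2).const_mul (snI x ^ 2)).const_sub 1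
  refine (h1.div h2 h).congr_deriv ?_
  simp only [reSnSnd, Pi.pow_apply]
  congr 1
  push_cast
  linear_combination (2 * snI x ^ 3 * snI y) * snDeriv_sq y

/-- For the real part `reSn x y` and the imaginary part `reSn y x`, this symmetry and the
antisymmetry of `reSnSnd` are the two Cauchy-Riemann equations. -/
theorem reSnFst_comm (x y : ℝ) : reSnFst y x = reSnFst x y := by
  simp only [reSnFst]; ring_nf

theorem reSnSnd_comm (x y : ℝ) : reSnSnd y x = -reSnSnd x y := by
  simp only [reSnSnd]
  rw [mul_comm (snI y ^ 2), ← neg_div]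
  ring_nf

theorem continuousOn_reSnFst :
    ContinuousOn (Function.uncurry reSnFst) (Set.univ ×ˢ Set.Ioo (-KI) KI) := by
  have h1 := continuous_snI
  have h2 := continuous_snDeriv
  refine ContinuousOn.div (by fun_prop) (by fun_prop) fun p hp => ?_
  exact pow_ne_zero _ (one_sub_snI_sq_mul_pos p.1 hp.2).ne'

theorem continuousOn_reSnSnd :
    ContinuousOn (Function.uncurry reSnSnd) (Set.univ ×ˢ Set.Ioo (-KI) KI) := by
  have h1 := continuous_snI
  refine ContinuousOn.div (by fun_prop) (by fun_prop) fun p hp => ?_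
  exact pow_ne_zero _ (one_sub_snI_sq_mul_pos p.1 hp.2).ne'

theorem continuous_reSn_fst {y : ℝ} (hy : y ∈ Set.Ioo (-KI) KI) :
    Continuous fun x => reSn x y :=
  continuous_iff_continuousAt.2 fun x =>
    (hasDerivAt_reSn_fst (one_sub_snI_sq_mul_pos x hy).ne').continuousAt

theorem continuous_reSn_snd {y : ℝ} (hy : y ∈ Set.Ioo (-KI) KI) :
    Continuous fun x => reSn y x :=
  continuous_iff_continuousAt.2 fun x =>
    (hasDerivAt_reSn_snd (by rw [mul_comm]; exact (one_sub_snI_sq_mul_pos x hy).ne')).continuousAt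

theorem continuous_reSnFst {y : ℝ} (hy : y ∈ Set.Ioo (-KI) KI) :
    Continuous fun x => reSnFst x y :=
  continuousOn_reSnFst.comp_continuous (f := fun x => (x, y)) (by fun_prop)
    fun x => ⟨Set.mem_univ _, hy⟩

theorem continuous_reSnSnd {y : ℝ} (hy : y ∈ Set.Ioo (-KI) KI) :
    Continuous fun x => reSnSnd x y :=
  continuousOn_reSnSnd.comp_continuous (f := fun x => (x, y)) (by fun_prop)
    fun x => ⟨Set.mem_univ _, hy⟩

/-! ### The sine integrals of `sn` by a contour shift -/

section SineCoefficient

variable {κ : ℝ}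

/-- Cauchy-Riemann turns the `y`-derivative of the real part into an `x`-derivative of the imaginary
part, which integration by parts moves onto the sine. No boundary term survives: the sine vanishes
at 0, and `reSn y KI = 0` because `sn'` vanishes at `K`. -/
theorem hasDerivAt_integral_reSn_sin {y : ℝ} (hy : y ∈ Set.Ioo (-KI) KI) :
    HasDerivAt (fun y => ∫ x in (0 : ℝ)..KI, reSn x y * Real.sin (κ * x))
      (κ * ∫ x in (0 : ℝ)..KI, reSn y x * Real.cos (κ * x)) y := by
  have h := hasDerivAt_intervalIntegral_of_continuousOn
    (f := fun x y => reSn x y * Real.sin (κ * x)) (f' := fun x y => reSnSnd x y * Real.sin (κ * x))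
    KI_pos.le isOpen_Ioo hy
    (fun x _ y hy => (hasDerivAt_reSn_snd (one_sub_snI_sq_mul_pos x hy).ne').mul_const _)
    (fun y hy => ((continuous_reSn_fst hy).mul (by fun_prop)).continuousOn)
    ((continuousOn_reSnSnd.mono (Set.prod_mono (Set.subset_univ _) le_rfl)).mul
      (by fun_prop : Continuous fun p : ℝ × ℝ => Real.sin (κ * p.1)).continuousOn)
  refine h.congr_deriv ?_
  have hp := intervalIntegral.integral_deriv_mul_eq_sub (a := 0) (b := KI)
    (u := fun x => reSn y x) (u' := fun x => reSnSnd y x)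
    (v := fun x => Real.sin (κ * x)) (v' := fun x => Real.cos (κ * x) * κ)
    (fun x _ => hasDerivAt_reSn_snd
      (by rw [mul_comm]; exact (one_sub_snI_sq_mul_pos x hy).ne'))
    (fun x _ => by simpa using ((hasDerivAt_id x).const_mul κ).sin)
    (Continuous.intervalIntegrable (by
      simp_rw [fun x => reSnSnd_comm x y]; exact (continuous_reSnSnd hy).neg) _ _)
    (Continuous.intervalIntegrable (by fun_prop) _ _)
  have e0 : reSn y KI = 0 := by simp [reSn, snDeriv_KI]
  rw [e0, intervalIntegral.integral_add] at hp
  · simp_rw [fun x => reSnSnd_comm x y] at hp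
    simp only [neg_mul, intervalIntegral.integral_neg, mul_zero, Real.sin_zero] at hp
    rw [← intervalIntegral.integral_const_mul]
    rw [show (fun x => κ * (reSn y x * Real.cos (κ * x)))
      = fun x => reSn y x * (Real.cos (κ * x) * κ) from funext fun x => by ring]
    linarith
  · refine Continuous.intervalIntegrable ?_ _ _
    simp_rw [fun x => reSnSnd_comm x y]
    exact (continuous_reSnSnd hy).neg.mul (by fun_prop)
  · exact ((continuous_reSn_snd hy).mul (by fun_prop)).intervalIntegrable _ _

/-- The companion equation. Here the boundary terms vanish because `cos(κK) = 0` and because `sn`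
vanishes at 0. -/
theorem hasDerivAt_integral_reSn_cos (hκ : Real.cos (κ * KI) = 0) {y : ℝ}
    (hy : y ∈ Set.Ioo (-KI) KI) :
    HasDerivAt (fun y => ∫ x in (0 : ℝ)..KI, reSn y x * Real.cos (κ * x))
      (κ * ∫ x in (0 : ℝ)..KI, reSn x y * Real.sin (κ * x)) y := by
  have h := hasDerivAt_intervalIntegral_of_continuousOn
    (f := fun x y => reSn y x * Real.cos (κ * x)) (f' := fun x y => reSnFst x y * Real.cos (κ * x))
    KI_pos.le isOpen_Ioo hy
    (fun x _ y hy => by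
      rw [← reSnFst_comm]
      exact (hasDerivAt_reSn_fst
        (by rw [mul_comm]; exact (one_sub_snI_sq_mul_pos x hy).ne')).mul_const _)
    (fun y hy => ((continuous_reSn_snd hy).mul (by fun_prop)).continuousOn)
    ((continuousOn_reSnFst.mono (Set.prod_mono (Set.subset_univ _) le_rfl)).mul
      (by fun_prop : Continuous fun p : ℝ × ℝ => Real.cos (κ * p.1)).continuousOn)
  refine h.congr_deriv ?_
  have hp := intervalIntegral.integral_deriv_mul_eq_sub (a := 0) (b := KI)
    (u := fun x => reSn x y) (u' := fun x => reSnFst x y)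
    (v := fun x => Real.cos (κ * x)) (v' := fun x => -Real.sin (κ * x) * κ)
    (fun x _ => hasDerivAt_reSn_fst (one_sub_snI_sq_mul_pos x hy).ne')
    (fun x _ => by simpa using ((hasDerivAt_id x).const_mul κ).cos)
    ((continuous_reSnFst hy).intervalIntegrable _ _)
    (Continuous.intervalIntegrable (by fun_prop) _ _)
  have e0 : reSn 0 y = 0 := by simp [reSn, snI_zero]
  rw [e0, hκ, intervalIntegral.integral_add] at hp
  · rw [← intervalIntegral.integral_const_mul]
    rw [show (fun x => reSn x y * (-Real.sin (κ * x) * κ))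
      = fun x => -(κ * (reSn x y * Real.sin (κ * x))) from funext fun x => by ring,
      intervalIntegral.integral_neg] at hp
    linarith
  · exact ((continuous_reSnFst hy).mul (by fun_prop)).intervalIntegrable _ _
  · exact ((continuous_reSn_fst hy).mul (by fun_prop)).intervalIntegrable _ _

/-- The two integrals satisfy `A' = κB`, `B' = κA` with `B(0) = 0`, hence `A = A(0) cosh(κy)`. -/
theorem integral_reSn_sin (hκ : Real.cos (κ * KI) = 0) {y : ℝ} (hy : y ∈ Set.Ioo (-KI) KI) :
    ∫ x in (0 : ℝ)..KI, reSn x y * Real.sin (κ * x)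
      = (∫ x in (0 : ℝ)..KI, snI x * Real.sin (κ * x)) * Real.cosh (κ * y) := by
  set A := fun y => ∫ x in (0 : ℝ)..KI, reSn x y * Real.sin (κ * x) with hA
  set B := fun y => ∫ x in (0 : ℝ)..KI, reSn y x * Real.cos (κ * x) with hB
  have hA' : ∀ y ∈ Set.Ioo (-KI) KI, HasDerivAt A (κ * B y) y := fun y hy =>
    hasDerivAt_integral_reSn_sin hy
  have hB' : ∀ y ∈ Set.Ioo (-KI) KI, HasDerivAt B (κ * A y) y := fun y hy =>
    hasDerivAt_integral_reSn_cos hκ hy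
  have h0 : (0 : ℝ) ∈ Set.Ioo (-KI) KI := ⟨by linarith [KI_pos], KI_pos⟩
  have e : ∀ c x : ℝ, HasDerivAt (fun y => Real.exp (c * y)) (Real.exp (c * x) * c) x :=
    fun c x => by simpa using ((hasDerivAt_id x).const_mul c).exp
  -- The system is diagonal in `A + σB` with `σ = ±1`; each combination is a pure exponential.
  have key : ∀ σ : ℝ, σ ^ 2 = 1 → (A y + σ * B y) * Real.exp (-σ * κ * y) = A 0 + σ * B 0 := by
    intro σ hσ
    have hd : ∀ x ∈ Set.Ioo (-KI) KI,
        HasDerivAt (fun y => (A y + σ * B y) * Real.exp (-σ * κ * y)) 0 x := fun x hx => by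
      refine (((hA' x hx).add ((hB' x hx).const_mul σ)).mul (e (-σ * κ) x)).congr_deriv ?_
      simp only [Pi.add_apply]
      linear_combination (-κ * B x * Real.exp (-σ * κ * x)) * hσ
    have := isOpen_Ioo.is_const_of_deriv_eq_zero isPreconnected_Ioo
      (fun x hx => (hd x hx).differentiableAt.differentiableWithinAt)
      (fun x hx => (hd x hx).deriv) hy h0
    simpa using this
  have hB0 : B 0 = 0 := by simp [hB, reSn, snI_zero]
  have hA0 : A 0 = ∫ x in (0 : ℝ)..KI, snI x * Real.sin (κ * x) := by
    simp [hA, reSn, snI_zero, snDeriv_zero]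
  have k1 := key 1 (by norm_num)
  have k2 := key (-1) (by norm_num)
  rw [← hA0, Real.cosh_eq]
  simp only [hB0, mul_zero, add_zero, neg_neg, one_mul, neg_mul] at k1 k2
  have x1 : Real.exp (-(κ * y)) * Real.exp (κ * y) = 1 := by rw [← Real.exp_add]; simp
  have : A y = A 0 * ((Real.exp (κ * y) + Real.exp (-(κ * y))) / 2) := by
    linear_combination (Real.exp (κ * y) / 2) * k1 + (Real.exp (-(κ * y)) / 2) * k2
      - A y * x1
  exact this

/-- An antiderivative of `reSn · y` on `[0, K(i)]`. -/
def reSnAnti (y x : ℝ) : ℝ :=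
  Real.arctan ((snI x ^ 2 / (1 + snDeriv x) - snI y ^ 2) / snDeriv y)

/-- The point `(sn² x, sn' x)` lies on the unit circle, so `sn² x / (1 + sn' x)` is the tangent of
half its angle and has derivative `2 sn x / (1 + sn' x)`. The same circle relation at `y` makes `1 +
(·)²`, the denominator from the arctangent, proportional to `1 - sn² x sn² y`. -/
theorem hasDerivAt_reSnAnti {x y : ℝ} (hx : x ∈ Set.Icc 0 KI) (hy : y ∈ Set.Ico 0 KI) :
    HasDerivAt (reSnAnti y) (reSn x y) x := by
  have hb := snDeriv_pos hy
  have hd := snDeriv_nonneg hx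
  have hD : 0 < 1 - snI x ^ 2 * snI y ^ 2 :=
    one_sub_snI_sq_mul_pos x ⟨by linarith [hy.1, KI_pos], hy.2⟩
  have h1 := ((hasDerivAt_snI x).pow 2).div ((hasDerivAt_snDeriv x).const_add 1)
    (by positivity : (1 + snDeriv x) ≠ 0)
  refine ((h1.sub_const (snI y ^ 2)).div_const (snDeriv y)).arctan.congr_deriv ?_
  simp only [reSn, Pi.pow_apply, Pi.div_apply, Nat.cast_ofNat, Nat.reduceSub, pow_one]
  have hx2 := snDeriv_sq x
  have hy2 := snDeriv_sq y
  have hd1 : 0 < 1 + snDeriv x := by positivity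
  generalize snI x = s at *
  generalize snI y = m at *
  generalize snDeriv x = d at *
  generalize snDeriv y = b at *
  have e1 : 2 * s * d * (1 + d) - s ^ 2 * (-2 * s ^ 3) = 2 * s * (1 + d) := by
    linear_combination (2 * s) * hx2
  have e2 : 1 + ((s ^ 2 / (1 + d) - m ^ 2) / b) ^ 2
      = 2 * (1 - s ^ 2 * m ^ 2) / (b ^ 2 * (1 + d)) := by
    field_simp
    linear_combination (1 + d) ^ 2 * hy2 + hx2
  rw [e1, e2]
  field_simp

theorem continuous_reSnAnti {y : ℝ} (hy : y ∈ Set.Ico 0 KI) :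
    ContinuousOn (reSnAnti y) (Set.Icc 0 KI) := fun _ hx =>
  (hasDerivAt_reSnAnti hx hy).continuousAt.continuousWithinAt

theorem tendsto_snDeriv_KI : Tendsto snDeriv (𝓝[Set.Ico 0 KI] KI) (𝓝[>] 0) := by
  refine tendsto_nhdsWithin_iff.2 ⟨?_, ?_⟩
  · rw [← snDeriv_KI]
    exact continuous_snDeriv.continuousAt.continuousWithinAt
  · filter_upwards [self_mem_nhdsWithin] with y hy using snDeriv_pos hy

theorem tendsto_snI_sq_KI : Tendsto (fun y => snI y ^ 2) (𝓝[Set.Ico 0 KI] KI) (𝓝 1) := by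
  have : ContinuousAt (fun y => snI y ^ 2) KI := (continuous_snI.pow 2).continuousAt
  have := this.tendsto.mono_left (nhdsWithin_le_nhds (s := Set.Ico 0 KI))
  simpa [snI_KI] using this

/-- The numerator tends to `sn² x / (1 + sn' x) - 1 < 0` while the denominator tends to 0 from
above, so the argument of the arctangent tends to `-∞`. -/
theorem tendsto_reSnAnti {x : ℝ} (hx : x ∈ Set.Ico 0 KI) :
    Tendsto (fun y => reSnAnti y x) (𝓝[Set.Ico 0 KI] KI) (𝓝 (-(Real.pi / 2))) := by
  have hx' : x ∈ Set.Icc 0 KI := ⟨hx.1, hx.2.le⟩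
  refine (tendsto_nhds_of_tendsto_nhdsWithin Real.tendsto_arctan_atBot).comp ?_
  have hlt : snI x ^ 2 / (1 + snDeriv x) - 1 < 0 := by
    have hd := snDeriv_pos hx
    rw [sub_neg, div_lt_one (by positivity)]
    linarith [snI_sq_le_one x]
  simp_rw [div_eq_mul_inv (_ - _)]
  exact (tendsto_const_nhds.sub tendsto_snI_sq_KI).neg_mul_atTop hlt
    (tendsto_inv_nhdsGT_zero.comp tendsto_snDeriv_KI)

/-- At the endpoint the quotient is `(1 - sn² y) / sn' y`, and `sn'² = (1 - sn²)(1 + sn²)` turns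
this `0/0` into `sn' y / (1 + sn² y)`. -/
theorem tendsto_reSnAnti_KI :
    Tendsto (fun y => reSnAnti y KI) (𝓝[Set.Ico 0 KI] KI) (𝓝 0) := by
  have hq : ∀ y ∈ Set.Ico 0 KI, (snI KI ^ 2 / (1 + snDeriv KI) - snI y ^ 2) / snDeriv y
      = snDeriv y / (1 + snI y ^ 2) := fun y hy => by
    have hb := snDeriv_pos hy
    rw [snI_KI, snDeriv_KI]
    field_simp
    linear_combination -snDeriv_sq y
  have h1 : Tendsto (fun y => snDeriv y / (1 + snI y ^ 2)) (𝓝[Set.Ico 0 KI] KI) (𝓝 0) := by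
    have := (tendsto_nhds_of_tendsto_nhdsWithin tendsto_snDeriv_KI).div
      (tendsto_const_nhds.add tendsto_snI_sq_KI : Tendsto (fun y => 1 + snI y ^ 2) _ (𝓝 (1 + 1)))
      (by norm_num)
    rw [zero_div] at this
    exact this
  have h2 := (Real.continuous_arctan.tendsto 0).comp h1
  rw [Real.arctan_zero] at h2
  refine h2.congr' ?_
  filter_upwards [self_mem_nhdsWithin] with y hy
  simp only [reSnAnti, Function.comp_apply, hq y hy]

instance nhdsWithin_KI_neBot : (𝓝[Set.Ico 0 KI] KI).NeBot := by
  rw [nhdsWithin_Ico_eq_nhdsLT KI_pos]; infer_instance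

/-- The trace of the pole at `K + iK`: the antiderivative tends to a step from `-π/2` to 0 at `x =
K`, so the densities concentrate there with mass `π/2`. Integrating by parts leaves the
antiderivative, bounded by `π/2`, under the integral, and dominated convergence applies. -/
theorem tendsto_integral_reSn_sin :
    Tendsto (fun y => ∫ x in (0 : ℝ)..KI, reSn x y * Real.sin (κ * x)) (𝓝[Set.Ico 0 KI] KI)
      (𝓝 (Real.pi / 2 * Real.sin (κ * KI))) := by
  have hparts : ∀ y ∈ Set.Ico 0 KI, ∫ x in (0 : ℝ)..KI, reSn x y * Real.sin (κ * x)
      = reSnAnti y KI * Real.sin (κ * KI)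
        - ∫ x in (0 : ℝ)..KI, reSnAnti y x * (Real.cos (κ * x) * κ) := fun y hy => by
    have hy' : y ∈ Set.Ioo (-KI) KI := ⟨by linarith [hy.1, KI_pos], hy.2⟩
    have hp := intervalIntegral.integral_deriv_mul_eq_sub (a := 0) (b := KI)
      (u := reSnAnti y) (u' := fun x => reSn x y)
      (v := fun x => Real.sin (κ * x)) (v' := fun x => Real.cos (κ * x) * κ)
      (fun x hx => hasDerivAt_reSnAnti (by rwa [Set.uIcc_of_le KI_pos.le] at hx) hy)
      (fun x _ => by simpa using ((hasDerivAt_id x).const_mul κ).sin)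
      ((continuous_reSn_fst hy').intervalIntegrable _ _)
      (Continuous.intervalIntegrable (by fun_prop) _ _)
    rw [intervalIntegral.integral_add] at hp
    · simp only [mul_zero, Real.sin_zero, sub_zero] at hp
      linarith
    · exact ((continuous_reSn_fst hy').mul (by fun_prop)).intervalIntegrable _ _
    · refine ContinuousOn.intervalIntegrable ?_
      rw [Set.uIcc_of_le KI_pos.le]
      exact (continuous_reSnAnti hy).mul (by fun_prop)
  have hlim : Tendsto (fun y => ∫ x in (0 : ℝ)..KI, reSnAnti y x * (Real.cos (κ * x) * κ))
      (𝓝[Set.Ico 0 KI] KI)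
      (𝓝 (∫ x in (0 : ℝ)..KI, -(Real.pi / 2) * (Real.cos (κ * x) * κ))) := by
    refine intervalIntegral.tendsto_integral_filter_of_dominated_convergence
      (fun _ => Real.pi / 2 * |κ|) ?_ ?_ intervalIntegrable_const ?_
    · filter_upwards [self_mem_nhdsWithin] with y hy
      refine ContinuousOn.aestronglyMeasurable ?_ measurableSet_uIoc
      rw [Set.uIoc_of_le KI_pos.le]
      exact ((continuous_reSnAnti hy).mono Set.Ioc_subset_Icc_self).mul (by fun_prop)
    · refine Eventually.of_forall fun y => Eventually.of_forall fun x _ => ?_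
      rw [norm_mul, norm_mul, Real.norm_eq_abs, Real.norm_eq_abs, Real.norm_eq_abs]
      gcongr
      · exact abs_le.2 ⟨(Real.neg_pi_div_two_lt_arctan _).le, (Real.arctan_lt_pi_div_two _).le⟩
      · exact mul_le_of_le_one_left (abs_nonneg _) (Real.abs_cos_le_one _)
    · have hne : ∀ᵐ x : ℝ, x ≠ KI := by simp [ae_iff]
      filter_upwards [hne] with x hne hx
      rw [Set.uIoc_of_le KI_pos.le] at hx
      exact (tendsto_reSnAnti ⟨hx.1.le, lt_of_le_of_ne hx.2 hne⟩).mul_const _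
  have h := (tendsto_reSnAnti_KI.mul_const (Real.sin (κ * KI))).sub hlim
  have hval : ∫ x in (0 : ℝ)..KI, -(Real.pi / 2) * (Real.cos (κ * x) * κ)
      = -(Real.pi / 2) * Real.sin (κ * KI) := by
    rw [intervalIntegral.integral_const_mul,
      intervalIntegral.integral_eq_sub_of_hasDerivAt (f := fun x => Real.sin (κ * x))
        (fun x _ => by simpa using ((hasDerivAt_id x).const_mul κ).sin)
        (Continuous.intervalIntegrable (by fun_prop) _ _)]
    simp
  rw [hval] at h
  rw [show Real.pi / 2 * Real.sin (κ * KI)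
    = 0 * Real.sin (κ * KI) - -(Real.pi / 2) * Real.sin (κ * KI) by ring]
  refine h.congr' ?_
  filter_upwards [self_mem_nhdsWithin] with y hy using (hparts y hy).symm

/-- The `cosh` law holds up to `y = K`, where the concentration at the pole evaluates the same
limit. -/
theorem integral_snI_mul_sin (hκ : Real.cos (κ * KI) = 0) :
    (∫ x in (0 : ℝ)..KI, snI x * Real.sin (κ * x)) * Real.cosh (κ * KI)
      = Real.pi / 2 * Real.sin (κ * KI) := by
  refine tendsto_nhds_unique ?_ (tendsto_integral_reSn_sin (κ := κ))
  have hc : Continuous fun y =>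
      (∫ x in (0 : ℝ)..KI, snI x * Real.sin (κ * x)) * Real.cosh (κ * y) := by fun_prop
  refine (hc.continuousAt.tendsto.mono_left nhdsWithin_le_nhds).congr' ?_
  filter_upwards [self_mem_nhdsWithin] with y hy
  exact (integral_reSn_sin hκ ⟨by linarith [hy.1, KI_pos], hy.2⟩).symm

end SineCoefficient

/-! ### The Fourier series of `sn(·, i)` -/

theorem norm_expWeight_le (n k : ℕ) :
    ‖((-1) ^ k * Real.exp (-((n + 1 / 2) * Real.pi))
      / (1 + Real.exp (-((2 * n + 1) * Real.pi))) : ℝ)‖ ≤ Real.exp (-Real.pi * n) := by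
  rw [norm_div, norm_mul, norm_pow, norm_neg, norm_one, one_pow, one_mul,
    Real.norm_of_nonneg (Real.exp_pos _).le, Real.norm_of_nonneg (by positivity)]
  refine (div_le_self (Real.exp_pos _).le (by simpa using (Real.exp_pos
    (-((2 * (n : ℝ) + 1) * Real.pi))).le)).trans (Real.exp_le_exp.2 ?_)
  nlinarith [Real.pi_pos]

theorem summable_abs_snCoeff : Summable fun n => |snCoeff n| := by
  have h := (Real.summable_pow_mul_exp_neg_nat_mul 0 Real.pi_pos).mul_left |2 * Real.pi / KI|
  refine Summable.of_nonneg_of_le (fun _ => abs_nonneg _) (fun n => ?_) h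
  rw [snCoeff, abs_mul, pow_zero, one_mul]
  exact mul_le_mul_of_nonneg_left (norm_expWeight_le n n) (abs_nonneg _)

theorem summable_abs_residueB : Summable fun n => |residueB n| := by
  have h0 := Real.summable_pow_mul_exp_neg_nat_mul 0 Real.pi_pos
  have h1 := Real.summable_pow_mul_exp_neg_nat_mul 1 Real.pi_pos
  have h := ((h1.mul_left 2).add h0).mul_left (Real.pi ^ 2 / KI ^ 2)
  refine Summable.of_nonneg_of_le (fun _ => abs_nonneg _) (fun n => ?_) h
  rw [residueB, abs_mul, abs_of_nonneg (by positivity : 0 ≤ (2 * (n : ℝ) + 1) *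
    (Real.pi ^ 2 / KI ^ 2))]
  refine (mul_le_mul_of_nonneg_left (norm_expWeight_le n (n + 1)) (by positivity)).trans_eq ?_
  ring

/-- With `a = (n + 1/2)π`, `e^{-a} / (1 + e^{-2a}) = 1 / (2 cosh a)`: this matches the series
coefficient to the output of the contour shift. -/
theorem snCoeff_eq (n : ℕ) :
    snCoeff n = Real.pi / KI * ((-1) ^ n / Real.cosh ((n + 1 / 2) * Real.pi)) := by
  have h : Real.exp (-((2 * n + 1) * Real.pi))
      = Real.exp (-((n + 1 / 2) * Real.pi)) * Real.exp (-((n + 1 / 2) * Real.pi)) := by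
    rw [← Real.exp_add]; ring_nf
  have h1 : Real.exp ((n + 1 / 2) * Real.pi) * Real.exp (-((n + 1 / 2) * Real.pi)) = 1 := by
    rw [← Real.exp_add]; simp
  have hK := KI_pos
  rw [snCoeff, h, Real.cosh_eq]
  have e1 := Real.exp_pos ((n + 1 / 2) * Real.pi)
  have e2 := Real.exp_pos (-((n + 1 / 2) * Real.pi))
  generalize Real.exp ((n + 1 / 2) * Real.pi) = E at *
  generalize Real.exp (-((n + 1 / 2) * Real.pi)) = F at *
  field_simp
  linear_combination h1

theorem integral_snI_mul_sin_odd (n : ℕ) :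
    ∫ x in (0 : ℝ)..KI, snI x * Real.sin ((2 * n + 1) * (Real.pi / (2 * KI)) * x)
      = KI / 2 * snCoeff n := by
  have hK := KI_pos
  have hk : (2 * n + 1) * (Real.pi / (2 * KI)) * KI = (n + 1 / 2) * Real.pi := by
    field_simp
  have hsin : Real.sin ((n + 1 / 2) * Real.pi) = (-1) ^ n := by
    rw [add_mul, Real.sin_add, Real.sin_nat_mul_pi, Real.cos_nat_mul_pi,
      show 1 / 2 * Real.pi = Real.pi / 2 by ring, Real.sin_pi_div_two]
    ring
  have hcos : Real.cos ((n + 1 / 2) * Real.pi) = 0 := by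
    rw [add_mul, Real.cos_add, Real.sin_nat_mul_pi,
      show 1 / 2 * Real.pi = Real.pi / 2 by ring, Real.cos_pi_div_two]
    ring
  have h := integral_snI_mul_sin (κ := (2 * n + 1) * (Real.pi / (2 * KI))) (by rw [hk, hcos])
  rw [hk, hsin] at h
  have hc := Real.cosh_pos ((n + 1 / 2) * Real.pi)
  rw [snCoeff_eq]
  rw [eq_div_iff hc.ne' |>.2 h]
  field_simp

instance fact_four_KI_pos : Fact (0 < 4 * KI) := ⟨by linarith [KI_pos]⟩

/-- `sn(·, i)` on the circle `ℝ / 4K(i)ℤ`. -/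
def snCircle : C(AddCircle (4 * KI), ℂ) where
  toFun := Function.Periodic.lift (f := fun x : ℝ => (snI x : ℂ)) (c := 4 * KI)
    fun x => by simp only [snI_add_four_KI]
  continuous_toFun := by
    refine continuous_coinduced_dom.2 ?_
    exact Complex.continuous_ofReal.comp continuous_snI

theorem snCircle_coe (x : ℝ) : snCircle (x : AddCircle (4 * KI)) = snI x := rfl

/-- Oddness folds `[-2K, 2K]` onto `[0, 2K]` and leaves a sine; the reflection `u ↦ 2K - u` folds
this onto `[0, K]` with the factor `1 - (-1)^m`, which removes the even harmonics. -/
theorem fourierCoeff_snCircle (m : ℤ) :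
    fourierCoeff snCircle m = (((-1) ^ m - 1) / (2 * KI) : ℝ) * Complex.I *
      (∫ x in (0 : ℝ)..KI, snI x * Real.sin (m * (Real.pi / (2 * KI)) * x) : ℝ) := by
  have hK := KI_pos
  have hs := continuous_snI
  have hsC : Continuous fun x : ℝ => (snI x : ℂ) := Complex.continuous_ofReal.comp hs
  set κ : ℝ := m * (Real.pi / (2 * KI)) with hκ
  set g : ℝ → ℝ := fun x => snI x * Real.sin (κ * x) with hg
  have hgc : Continuous g := by fun_prop
  have hrefl : ∀ x, g (2 * KI - x) = -(-1) ^ m * g x := fun x => by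
    have : κ * (2 * KI - x) = m * Real.pi - κ * x := by rw [hκ]; field_simp
    simp only [hg]
    rw [snI_two_KI_sub, this, Real.sin_sub, Real.sin_int_mul_pi, Real.cos_int_mul_pi]
    ring
  have h2 : ∫ x in (0 : ℝ)..(2 * KI), g x = (1 - (-1) ^ m) * ∫ x in (0 : ℝ)..KI, g x := by
    rw [← intervalIntegral.integral_add_adjacent_intervals (hgc.intervalIntegrable 0 KI)
      (hgc.intervalIntegrable KI (2 * KI))]
    have := intervalIntegral.integral_comp_sub_left (a := 0) (b := KI) g (2 * KI)
    simp only [hrefl, intervalIntegral.integral_const_mul, sub_zero] at this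
    rw [show 2 * KI - KI = KI by ring] at this
    rw [← this]
    ring
  set f : ℝ → ℂ := fun x => Complex.exp (-(Complex.I * κ * x)) * snI x with hf
  have hfc : Continuous f := by
    refine Continuous.mul (by fun_prop) hsC
  have hcoef := fourierCoeff_eq_intervalIntegral (T := 4 * KI) (⇑snCircle) m (-(2 * KI))
  rw [hcoef, show -(2 * KI) + 4 * KI = 2 * KI by ring]
  have hfi : ∀ x : ℝ, (fourier (-m) (x : AddCircle (4 * KI))) • snCircle x = f x := fun x => by
    rw [fourier_coe_apply, snCircle_coe, smul_eq_mul, hf]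
    simp only [hκ]
    congr 2
    have : (KI : ℂ) ≠ 0 := by exact_mod_cast hK.ne'
    push_cast
    field_simp
    ring
  simp only [hfi]
  rw [← intervalIntegral.integral_add_adjacent_intervals (hfc.intervalIntegrable _ 0)
      (hfc.intervalIntegrable 0 (2 * KI))]
  have hneg := intervalIntegral.integral_comp_neg (a := 0) (b := 2 * KI) f
  rw [neg_zero] at hneg
  have hfn : Continuous fun x => f (-x) := hfc.comp continuous_neg
  rw [← hneg, ← intervalIntegral.integral_add (hfn.intervalIntegrable _ _)
    (hfc.intervalIntegrable _ _)]
  have hsum : ∀ x, f (-x) + f x = -(2 * Complex.I) * (g x : ℂ) := fun x => by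
    simp only [hf, hg, snI_neg]
    push_cast
    rw [Complex.sin]
    have e1 : (κ : ℂ) * x * Complex.I = Complex.I * κ * x := by ring
    have e2 : -((κ : ℂ) * x) * Complex.I = -(Complex.I * κ * x) := by ring
    have e3 : -(Complex.I * κ * -(x : ℂ)) = Complex.I * κ * x := by ring
    rw [e1, e2, e3]
    linear_combination ((snI x : ℂ) * Complex.exp (-(Complex.I * κ * x))
      - snI x * Complex.exp (Complex.I * κ * x)) * Complex.I_sq
  simp only [hsum, intervalIntegral.integral_const_mul, intervalIntegral.integral_ofReal, h2]
  rw [Complex.real_smul]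
  have : (KI : ℂ) ≠ 0 := by exact_mod_cast hK.ne'
  push_cast
  field_simp
  ring

theorem fourierCoeff_snCircle_odd (n : ℕ) :
    fourierCoeff snCircle (2 * n + 1) = -Complex.I / 2 * (snCoeff n : ℂ) := by
  have hK : (KI : ℂ) ≠ 0 := by exact_mod_cast KI_pos.ne'
  rw [fourierCoeff_snCircle, Odd.neg_one_zpow ⟨n, rfl⟩]
  push_cast [integral_snI_mul_sin_odd]
  field_simp
  norm_num

theorem fourierCoeff_snCircle_neg_odd (n : ℕ) :
    fourierCoeff snCircle (2 * (-(n + 1 : ℤ)) + 1) = Complex.I / 2 * (snCoeff n : ℂ) := by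
  have hK : (KI : ℂ) ≠ 0 := by exact_mod_cast KI_pos.ne'
  rw [fourierCoeff_snCircle, Odd.neg_one_zpow ⟨_, rfl⟩]
  have : ∀ x, snI x * Real.sin (((2 * (-(n + 1 : ℤ)) + 1 : ℤ) : ℝ) * (Real.pi / (2 * KI)) * x)
      = -(snI x * Real.sin ((2 * n + 1) * (Real.pi / (2 * KI)) * x)) := fun x => by
    rw [← mul_neg, ← Real.sin_neg]
    push_cast
    ring_nf
  simp only [this, intervalIntegral.integral_neg]
  push_cast [integral_snI_mul_sin_odd]
  field_simp
  norm_num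

theorem fourierCoeff_snCircle_even {m : ℤ} (hm : Even m) : fourierCoeff snCircle m = 0 := by
  rw [fourierCoeff_snCircle, Even.neg_one_zpow hm]
  simp

theorem injective_two_mul_add_one : Function.Injective fun k : ℤ => 2 * k + 1 := fun a b h => by
  simp only at h; omega

theorem even_of_notMem_range {m : ℤ} (hm : m ∉ Set.range fun k : ℤ => 2 * k + 1) : Even m := by
  by_contra h
  obtain ⟨k, hk⟩ := Int.not_even_iff_odd.1 h
  exact hm ⟨k, hk.symm⟩

theorem summable_fourierCoeff_snCircle : Summable (fourierCoeff snCircle) := by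
  rw [← injective_two_mul_add_one.summable_iff
    (fun m hm => fourierCoeff_snCircle_even (even_of_notMem_range hm))]
  have h : Summable fun n => ‖(snCoeff n : ℂ)‖ := by
    simpa using summable_abs_snCoeff
  refine Summable.of_nat_of_neg_add_one ?_ ?_
  · simp only [Function.comp_def]
    simp only [fourierCoeff_snCircle_odd]
    exact h.of_norm.mul_left _
  · simp only [Function.comp_def]
    simp only [fourierCoeff_snCircle_neg_odd]
    exact h.of_norm.mul_left _

theorem hasSum_snI (u : ℝ) : HasSum
    (fun n : ℕ => snCoeff n * Real.sin ((2 * n + 1) * (Real.pi * u / (2 * KI)))) (snI u) := by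
  have h := has_pointwise_sum_fourier_series_of_summable summable_fourierCoeff_snCircle u
  rw [snCircle_coe, ← injective_two_mul_add_one.hasSum_iff
    (fun m hm => by rw [fourierCoeff_snCircle_even (even_of_notMem_range hm), zero_smul])] at h
  -- The indices `n` and `-(n + 1)` carry the frequencies `2n + 1` and `-(2n + 1)`, whose
  -- exponentials combine into one sine.
  have h' := h.nat_add_neg_add_one
  rw [← Complex.hasSum_ofReal]
  refine h'.congr_fun fun n => ?_
  have hK : (KI : ℂ) ≠ 0 := by exact_mod_cast KI_pos.ne'
  simp only [Function.comp_apply, fourierCoeff_snCircle_odd, fourierCoeff_snCircle_neg_odd,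
    fourier_coe_apply, smul_eq_mul]
  push_cast
  rw [Complex.sin]
  have e1 : 2 * (Real.pi : ℂ) * Complex.I * (2 * n + 1) * u / (4 * KI)
      = (2 * n + 1) * (Real.pi * u / (2 * KI)) * Complex.I := by field_simp; ring
  have e2 : 2 * (Real.pi : ℂ) * Complex.I * (2 * (-(n + 1)) + 1) * u / (4 * KI)
      = -((2 * n + 1) * (Real.pi * u / (2 * KI))) * Complex.I := by field_simp; ring
  rw [e1, e2]
  ring

/-! ### Green functions of `H'' + V'(H) = c δ`: existence and uniqueness -/

section GreenFunction

variable {dV : ℝ → ℝ} {c : ℝ}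

/-- Because `g'' = -V'(g)`, the integrand `g φ'' + V'(g) φ` is the derivative of `g φ' - g' φ`. On
`(0, ∞)` only the boundary value at 0 remains, and it is `g'(0) φ(0) = c φ(0)`. -/
theorem isGreenFunction_indicator {g g' : ℝ → ℝ} (hdV : Continuous dV) (h0 : dV 0 = 0)
    (hg : ∀ t, HasDerivAt g (g' t) t) (hg' : ∀ t, HasDerivAt g' (-dV (g t)) t)
    (hg0 : g 0 = 0) (hg'0 : g' 0 = c) :
    IsGreenFunction dV c ((Set.Ici 0).indicator g) := by
  have cg : Continuous g := continuous_iff_continuousAt.2 fun t => (hg t).continuousAt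
  have cg' : Continuous g' := continuous_iff_continuousAt.2 fun t => (hg' t).continuousAt
  have hcomp : (fun t => dV ((Set.Ici 0).indicator g t))
      = (Set.Ici 0).indicator fun t => dV (g t) := by
    ext t
    by_cases ht : t ∈ Set.Ici (0 : ℝ) <;> simp [ht, h0]
  refine ⟨cg.locallyIntegrable.indicator measurableSet_Ici, ?_, fun φ hφ hφc => ?_⟩
  · rw [hcomp]
    exact (hdV.comp cg).locallyIntegrable.indicator measurableSet_Ici
  have hφ1 : ContDiff ℝ ((⊤ : ℕ∞) : WithTop ℕ∞) (deriv φ) := (contDiff_infty_iff_deriv.1 hφ).2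
  have hφ2 : ContDiff ℝ ((⊤ : ℕ∞) : WithTop ℕ∞) (deriv (deriv φ)) :=
    (contDiff_infty_iff_deriv.1 hφ1).2
  have hd0 : ∀ t, HasDerivAt φ (deriv φ t) t := fun t =>
    ((contDiff_infty_iff_deriv.1 hφ).1 t).hasDerivAt
  have hd1 : ∀ t, HasDerivAt (deriv φ) (deriv (deriv φ) t) t := fun t =>
    ((contDiff_infty_iff_deriv.1 hφ1).1 t).hasDerivAt
  have hcs1 : HasCompactSupport (deriv φ) := hφc.deriv
  have hcs2 : HasCompactSupport (deriv (deriv φ)) := hcs1.deriv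
  have e2 : iteratedDeriv 2 φ = deriv (deriv φ) := by
    rw [iteratedDeriv_succ, iteratedDeriv_one]
  have i1 : Integrable fun t => g t * deriv (deriv φ) t :=
    (cg.mul hφ2.continuous).integrable_of_hasCompactSupport hcs2.mul_left
  have i2 : Integrable fun t => dV (g t) * φ t :=
    ((hdV.comp cg).mul hφ.continuous).integrable_of_hasCompactSupport hφc.mul_left
  have s1 : (fun t => (Set.Ici 0).indicator g t * deriv (deriv φ) t)
      = (Set.Ici 0).indicator fun t => g t * deriv (deriv φ) t := by
    ext t
    by_cases ht : t ∈ Set.Ici (0 : ℝ) <;> simp [ht]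
  have s2 : (fun t => dV ((Set.Ici 0).indicator g t) * φ t)
      = (Set.Ici 0).indicator fun t => dV (g t) * φ t := by
    ext t
    by_cases ht : t ∈ Set.Ici (0 : ℝ) <;> simp [ht, h0]
  rw [e2, s1, s2, integral_indicator measurableSet_Ici, integral_indicator measurableSet_Ici,
    integral_Ici_eq_integral_Ioi, integral_Ici_eq_integral_Ioi,
    ← integral_add i1.integrableOn i2.integrableOn]
  have hW : ∀ t ∈ Set.Ici (0 : ℝ), HasDerivAt (fun t => g t * deriv φ t - g' t * φ t)
      (g t * deriv (deriv φ) t + dV (g t) * φ t) t := fun t _ => by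
    refine (((hg t).mul (hd1 t)).sub ((hg' t).mul (hd0 t))).congr_deriv ?_
    ring
  have hWc : HasCompactSupport fun t => g t * deriv φ t - g' t * φ t :=
    (hcs1.mul_left (f := g)).sub (hφc.mul_left (f := g'))
  have hlim : Tendsto (fun t => g t * deriv φ t - g' t * φ t) atTop (𝓝 0) :=
    hWc.is_zero_at_infty.mono_left atTop_le_cocompact
  rw [integral_Ioi_of_hasDerivAt_of_tendsto' hW (i1.add i2).integrableOn hlim, hg0, hg'0]
  ring

theorem locallyIntegrable_comp_neg {f : ℝ → ℝ} (hf : LocallyIntegrable f) :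
    LocallyIntegrable fun t => f (-t) := by
  refine (locallyIntegrable_map_homeomorph (Homeomorph.neg ℝ)).1 ?_
  have : Measure.map (Homeomorph.neg ℝ) volume = (volume : Measure ℝ) :=
    Measure.map_neg_eq_self volume
  rwa [this]

theorem IsGreenFunction.comp_neg {H : ℝ → ℝ} (h : IsGreenFunction dV c H) :
    IsGreenFunction dV c fun t => H (-t) := by
  refine ⟨locallyIntegrable_comp_neg h.1, locallyIntegrable_comp_neg h.2, fun φ hφ hφc => ?_⟩
  have hφn : ContDiff ℝ ((⊤ : ℕ∞) : WithTop ℕ∞) fun t => φ (-t) := hφ.comp contDiff_neg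
  have := h.equation (fun t => φ (-t)) hφn (hφc.comp_homeomorph (Homeomorph.neg ℝ))
  rw [neg_zero] at this
  rw [← this, ← integral_neg_eq_self fun t => H t * iteratedDeriv 2 (fun t => φ (-t)) t,
    ← integral_neg_eq_self fun t => dV (H t) * φ (-t)]
  simp [iteratedDeriv_comp_neg]

theorem intervalIntegrable_of_locallyIntegrable {f : ℝ → ℝ} (hf : LocallyIntegrable f) (a b : ℝ) :
    IntervalIntegrable f volume a b :=
  intervalIntegrable_iff.2
    ((hf.integrableOn_isCompact isCompact_uIcc).mono_set Set.uIoc_subset_uIcc)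

theorem integral_eq_intervalIntegral_of_ae {f : ℝ → ℝ} {R : ℝ} (hR : 0 ≤ R)
    (h0 : ∀ᵐ t, t < 0 → f t = 0) (h1 : ∀ t, R < t → f t = 0) :
    ∫ t, f t = ∫ t in (0 : ℝ)..R, f t := by
  rw [intervalIntegral.integral_of_le hR]
  refine (setIntegral_eq_integral_of_ae_compl_eq_zero ?_).symm
  have hne : ∀ᵐ t : ℝ, t ≠ 0 := by simp [ae_iff]
  filter_upwards [h0, hne] with t h0 hne ht
  rcases lt_or_gt_of_ne hne with h | h
  · exact h0 h
  · exact h1 t (not_le.1 fun h' => ht ⟨h, h'⟩)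

/-- Two integrations by parts. As `F` is only locally integrable, its primitive is merely absolutely
continuous, which decides the version used for the first one. -/
theorem integral_mul_eq_integral_iterated {F φ ψ χ : ℝ → ℝ} {R : ℝ}
    (hF : LocallyIntegrable F) (hφ : ∀ t, HasDerivAt φ (ψ t) t) (hψ : ∀ t, HasDerivAt ψ (χ t) t)
    (hχ : Continuous χ) (hφR : φ R = 0) (hψR : ψ R = 0) :
    ∫ t in (0 : ℝ)..R, F t * φ t
      = ∫ t in (0 : ℝ)..R, (∫ r in (0 : ℝ)..t, ∫ q in (0 : ℝ)..r, F q) * χ t := by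
  have cψ : Continuous ψ := continuous_iff_continuousAt.2 fun t => (hψ t).continuousAt
  have hFi : ∀ a b, IntervalIntegrable F volume a b :=
    intervalIntegrable_of_locallyIntegrable hF
  have cV : Continuous fun r => ∫ q in (0 : ℝ)..r, F q :=
    intervalIntegral.continuous_primitive hFi 0
  have dφ : deriv φ = ψ := funext fun t => (hφ t).deriv
  have acφ : AbsolutelyContinuousOnInterval φ 0 R := by
    refine ContDiffOn.absolutelyContinuousOnInterval (ContDiff.contDiffOn ?_)
    rw [contDiff_one_iff_deriv]
    exact ⟨fun t => (hφ t).differentiableAt, dφ ▸ cψ⟩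
  have acV := (hFi 0 R).absolutelyContinuousOnInterval_intervalIntegral (c := 0)
    Set.left_mem_uIcc
  have h1 := AbsolutelyContinuousOnInterval.integral_mul_deriv_eq_deriv_mul acV acφ
  have h2 : ∫ t in (0 : ℝ)..R, deriv (fun r => ∫ q in (0 : ℝ)..r, F q) t * φ t
      = ∫ t in (0 : ℝ)..R, F t * φ t := by
    refine intervalIntegral.integral_congr_ae ?_
    filter_upwards [LocallyIntegrable.ae_hasDerivAt_integral hF] with t ht _
    rw [(ht 0).deriv]
  rw [h2, hφR, dφ] at h1
  have h3 := intervalIntegral.integral_mul_deriv_eq_deriv_mul (a := 0) (b := R)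
    (u := fun t => ∫ r in (0 : ℝ)..t, ∫ q in (0 : ℝ)..r, F q)
    (fun t _ => intervalIntegral.integral_hasDerivAt_right (cV.intervalIntegrable _ _)
      (cV.stronglyMeasurableAtFilter _ _) cV.continuousAt) (fun t _ => hψ t)
    (cV.intervalIntegrable _ _) (hχ.intervalIntegrable _ _)
  rw [hψR] at h3
  simp only [intervalIntegral.integral_same, mul_zero, zero_mul, sub_zero, zero_sub] at h1 h3
  linarith

theorem continuous_iterated_integral {F : ℝ → ℝ} (hF : LocallyIntegrable F) :
    Continuous fun t => ∫ r in (0 : ℝ)..t, ∫ q in (0 : ℝ)..r, F q := by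
  have cV : Continuous fun r => ∫ q in (0 : ℝ)..r, F q :=
    intervalIntegral.continuous_primitive (intervalIntegrable_of_locallyIntegrable hF) 0
  exact intervalIntegral.continuous_primitive (fun _ _ => cV.intervalIntegrable _ _) 0

/-- Both integrations start at `R`, so the results vanish to the right of `R`. They need not vanish
on the left, and a cutoff is required before `φ` can serve as a test function. -/
theorem exists_twofold_antiderivative {χ : ℝ → ℝ}
    (hχ : ContDiff ℝ ((⊤ : ℕ∞) : WithTop ℕ∞) χ) {R : ℝ} (hR : ∀ t, R < t → χ t = 0) :
    ∃ φ ψ : ℝ → ℝ, ContDiff ℝ ((⊤ : ℕ∞) : WithTop ℕ∞) φ ∧ (∀ t, HasDerivAt φ (ψ t) t) ∧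
      (∀ t, HasDerivAt ψ (χ t) t) ∧ ψ R = 0 ∧ ∀ t, R ≤ t → φ t = 0 := by
  have prim : ∀ {f : ℝ → ℝ}, Continuous f → ∀ t, HasDerivAt (fun t => ∫ s in R..t, f s) (f t) t :=
    fun hf t => intervalIntegral.integral_hasDerivAt_right (hf.intervalIntegrable _ _)
      (hf.stronglyMeasurableAtFilter _ _) hf.continuousAt
  have smooth : ∀ {f g : ℝ → ℝ}, (∀ t, HasDerivAt g (f t) t) →
      ContDiff ℝ ((⊤ : ℕ∞) : WithTop ℕ∞) f → ContDiff ℝ ((⊤ : ℕ∞) : WithTop ℕ∞) g :=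
    fun {f g} hg hf => contDiff_infty_iff_deriv.2 ⟨fun t => (hg t).differentiableAt, by
      rwa [show deriv g = f from funext fun t => (hg t).deriv]⟩
  have zero : ∀ {f : ℝ → ℝ}, (∀ t, R < t → f t = 0) → ∀ t, R ≤ t → ∫ s in R..t, f s = 0 := by
    intro f hf t ht
    rw [intervalIntegral.integral_of_le ht]
    exact setIntegral_eq_zero_of_forall_eq_zero fun s hs => hf s hs.1
  have hψ := prim hχ.continuous
  have sψ := smooth hψ hχ
  have hφ := prim sψ.continuous
  exact ⟨_, _, smooth hφ sψ, hφ, hψ, zero hR R le_rfl,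
    zero fun t ht => zero hR t ht.le⟩

/-- A forward-propagating solution satisfies the integrated equation on `t > 0`. -/
theorem IsGreenFunction.ae_eq_integral {H : ℝ → ℝ} (h : IsGreenFunction dV c H) (h0 : dV 0 = 0)
    (hneg : ∀ᵐ t, t < 0 → H t = 0) :
    ∀ᵐ t, 0 < t → H t = c * t - ∫ r in (0 : ℝ)..t, ∫ q in (0 : ℝ)..r, dV (H q) := by
  set F : ℝ → ℝ := fun t => dV (H t) with hF
  set U : ℝ → ℝ := fun t => ∫ r in (0 : ℝ)..t, ∫ q in (0 : ℝ)..r, F q with hU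
  have cU : Continuous U := continuous_iterated_integral h.2
  have cE : Continuous fun t => c * t - U t := by fun_prop
  have hloc : LocallyIntegrable ((Set.Ioi 0).indicator fun t => H t - (c * t - U t)) :=
    (h.1.sub cE.locallyIntegrable).indicator measurableSet_Ioi
  suffices hz : ∀ᵐ t, (Set.Ioi 0).indicator (fun t => H t - (c * t - U t)) t = 0 by
    filter_upwards [hz] with t ht hpos
    rw [Set.indicator_of_mem (Set.mem_Ioi.2 hpos)] at ht
    linarith
  -- It suffices to test against smooth compactly supported `χ`; the equation is then applied to a
  -- twofold antiderivative of `χ`.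
  refine ae_eq_zero_of_integral_contDiff_smul_eq_zero hloc fun χ hχ hχc => ?_
  obtain ⟨R', hR'⟩ := hχc.isCompact.isBounded.subset_closedBall 0
  set R := max R' 1 with hRdef
  have hR : 0 < R := lt_max_of_lt_right one_pos
  have hχR : ∀ t, R < t → χ t = 0 := fun t ht => by
    by_contra hne
    have := hR' (subset_tsupport χ hne)
    rw [Metric.mem_closedBall, Real.dist_eq, sub_zero] at this
    linarith [le_abs_self t, le_max_left R' 1]
  obtain ⟨φ, ψ, sφ, hφ, hψ, hψR, hφR⟩ := exists_twofold_antiderivative hχ hχR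
  -- A left cutoff, equal to 1 for `t > -1` and 0 for `t < -2`. It changes `φ` only where `H`
  -- vanishes, so it does not affect the integrals.
  set η : ℝ → ℝ := fun t => Real.smoothTransition (t + 2) with hη
  have sη : ContDiff ℝ ((⊤ : ℕ∞) : WithTop ℕ∞) η :=
    Real.smoothTransition.contDiff.comp (contDiff_id.add contDiff_const)
  have hη1 : ∀ t, -1 < t → η t = 1 := fun t ht =>
    Real.smoothTransition.one_of_one_le (by linarith)
  have hη0 : ∀ t, t < -2 → η t = 0 := fun t ht =>
    Real.smoothTransition.zero_of_nonpos (by linarith)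
  have hsupp : HasCompactSupport fun t => η t * φ t := by
    refine HasCompactSupport.of_support_subset_isCompact (isCompact_Icc (a := -2) (b := R)) ?_
    intro t ht
    refine ⟨?_, ?_⟩
    · by_contra hlt
      exact ht (by simp [hη0 t (not_le.1 hlt)])
    · by_contra hlt
      exact ht (by simp [hφR t (not_le.1 hlt).le])
  have heq := h.equation (fun t => η t * φ t) (sη.mul sφ) hsupp
  have hloc1 : ∀ t, -1 < t → iteratedDeriv 2 (fun t => η t * φ t) t = χ t := fun t ht => by
    have hev : (fun t => η t * φ t) =ᶠ[𝓝 t] φ := by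
      filter_upwards [lt_mem_nhds ht] with s hs
      rw [hη1 s hs, one_mul]
    rw [hev.iteratedDeriv_eq 2, iteratedDeriv_succ, iteratedDeriv_one,
      show deriv φ = ψ from funext fun t => (hφ t).deriv, (hψ t).deriv]
  have i1 : ∫ t, H t * iteratedDeriv 2 (fun t => η t * φ t) t = ∫ t in (0 : ℝ)..R, H t * χ t := by
    rw [← integral_eq_intervalIntegral_of_ae hR.le]
    · refine integral_congr_ae ?_
      filter_upwards [hneg] with t ht
      rcases lt_or_ge t 0 with h' | h'
      · simp [ht h']
      · simp only [hloc1 t (by linarith)]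
    · filter_upwards [hneg] with t ht h'
      rw [ht h', zero_mul]
    · exact fun t ht => by rw [hχR t ht, mul_zero]
  have i2 : ∫ t, dV (H t) * (η t * φ t) = ∫ t in (0 : ℝ)..R, F t * φ t := by
    rw [← integral_eq_intervalIntegral_of_ae hR.le]
    · refine integral_congr_ae ?_
      filter_upwards [hneg] with t ht
      rcases lt_or_ge t 0 with h' | h'
      · simp [hF, ht h', h0]
      · simp only [hF, hη1 t (by linarith), one_mul]
    · filter_upwards [hneg] with t ht h'
      rw [hF]
      simp only [ht h', h0, zero_mul]
    · exact fun t ht => by rw [hφR t ht.le, mul_zero]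
  have i3 := integral_mul_eq_integral_iterated h.2 hφ hψ hχ.continuous (hφR R le_rfl) hψR
  have cψ : Continuous ψ := continuous_iff_continuousAt.2 fun t => (hψ t).continuousAt
  -- The source `c φ(0)` thereby becomes the linear term `c t` paired with `χ`.
  have i4 : ∫ t in (0 : ℝ)..R, t * χ t = φ 0 := by
    rw [intervalIntegral.integral_mul_deriv_eq_deriv_mul (u := fun t => t)
      (fun t _ => hasDerivAt_id' t) (fun t _ => hψ t) intervalIntegrable_const (hχ.continuous.intervalIntegrable _ _)]
    simp only [one_mul]
    rw [intervalIntegral.integral_eq_sub_of_hasDerivAt (fun t _ => hφ t)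
      (cψ.intervalIntegrable _ _), hψR, hφR R le_rfl]
    simp
  have hind : ∫ t, χ t • (Set.Ioi 0).indicator (fun t => H t - (c * t - U t)) t
      = ∫ t in (0 : ℝ)..R, (H t * χ t - c * (t * χ t) + U t * χ t) := by
    rw [integral_eq_intervalIntegral_of_ae hR.le]
    · rw [intervalIntegral.integral_of_le hR.le, intervalIntegral.integral_of_le hR.le]
      refine setIntegral_congr_fun measurableSet_Ioc fun t ht => ?_
      simp only [Set.indicator_of_mem (Set.mem_Ioi.2 ht.1), smul_eq_mul]
      ring
    · refine Eventually.of_forall fun t ht => ?_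
      rw [Set.indicator_of_notMem (by simpa using ht.le), smul_zero]
    · exact fun t ht => by rw [hχR t ht, zero_smul]
  have cχ := hχ.continuous
  have iH : IntervalIntegrable (fun t => H t * χ t) volume 0 R :=
    (intervalIntegrable_of_locallyIntegrable h.1 0 R).mul_continuousOn cχ.continuousOn
  have it : IntervalIntegrable (fun t => c * (t * χ t)) volume 0 R :=
    Continuous.intervalIntegrable (by fun_prop) _ _
  have iU : IntervalIntegrable (fun t => U t * χ t) volume 0 R :=
    Continuous.intervalIntegrable (by fun_prop) _ _
  rw [hind, intervalIntegral.integral_add (iH.sub it) iU, intervalIntegral.integral_sub iH it,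
    intervalIntegral.integral_const_mul, i4, ← i3, ← i1, ← i2]
  simp only [hη1 0 (by norm_num), one_mul] at heq
  linarith

/-- Two continuous solutions of the integrated equation agree. -/
theorem eq_of_integral_equation (hdV : ContDiff ℝ 1 dV) {E₁ E₂ : ℝ → ℝ} (c₁ : Continuous E₁)
    (c₂ : Continuous E₂)
    (h₁ : ∀ t, 0 ≤ t → E₁ t = c * t - ∫ r in (0 : ℝ)..t, ∫ q in (0 : ℝ)..r, dV (E₁ q))
    (h₂ : ∀ t, 0 ≤ t → E₂ t = c * t - ∫ r in (0 : ℝ)..t, ∫ q in (0 : ℝ)..r, dV (E₂ q))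
    {T : ℝ} (hT : 0 ≤ T) : E₁ T = E₂ T := by
  obtain ⟨M₁, hM₁⟩ := isCompact_Icc.exists_bound_of_continuousOn
    (c₁.continuousOn (s := Set.Icc 0 T))
  obtain ⟨M₂, hM₂⟩ := isCompact_Icc.exists_bound_of_continuousOn
    (c₂.continuousOn (s := Set.Icc 0 T))
  -- Both solutions stay in `[-M, M]` on `[0, T]`, where `dV` is Lipschitz; no global Lipschitz
  -- bound is available for a cubic.
  set M := max M₁ M₂
  obtain ⟨L, hL⟩ := LocallyLipschitzOn.exists_lipschitzOnWith_of_compact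
    (isCompact_Icc (a := -M) (b := M)) (hdV.locallyLipschitz.locallyLipschitzOn (s := _))
  have cdV := hdV.continuous
  set D : ℝ → ℝ := fun t => |E₁ t - E₂ t| with hD
  have cD : Continuous D := by fun_prop
  have hlip : ∀ q ∈ Set.Icc 0 T, |dV (E₁ q) - dV (E₂ q)| ≤ L * D q := fun q hq => by
    have := hL.dist_le_mul (E₁ q) (abs_le.1 ((hM₁ q hq).trans (le_max_left _ _))) (E₂ q)
      (abs_le.1 ((hM₂ q hq).trans (le_max_right _ _)))
    simpa [Real.dist_eq] using this
  have hLT : (0 : ℝ) ≤ L := L.2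
  set f : ℝ → ℝ := fun t => ∫ q in (0 : ℝ)..t, D q with hf
  have hD0 : ∀ t, 0 ≤ D t := fun t => abs_nonneg _
  have hfmono : ∀ r t, 0 ≤ r → r ≤ t → f r ≤ f t := fun r t h0 hrt =>
    intervalIntegral.integral_mono_interval le_rfl h0 hrt
      (Eventually.of_forall hD0) (cD.intervalIntegrable _ _)
  have hf0 : ∀ t, 0 ≤ t → 0 ≤ f t := fun t ht =>
    intervalIntegral.integral_nonneg ht fun s _ => hD0 s
  have i1 : Continuous fun q => dV (E₁ q) := cdV.comp c₁
  have i2 : Continuous fun q => dV (E₂ q) := cdV.comp c₂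
  have p1 : Continuous fun r => ∫ q in (0 : ℝ)..r, dV (E₁ q) :=
    intervalIntegral.continuous_primitive (fun _ _ => i1.intervalIntegrable _ _) 0
  have p2 : Continuous fun r => ∫ q in (0 : ℝ)..r, dV (E₂ q) :=
    intervalIntegral.continuous_primitive (fun _ _ => i2.intervalIntegrable _ _) 0
  have hbound : ∀ t ∈ Set.Icc 0 T, D t ≤ T * L * f t := fun t ht => by
    have e : E₁ t - E₂ t = -∫ r in (0 : ℝ)..t, ∫ q in (0 : ℝ)..r, (dV (E₁ q) - dV (E₂ q)) := by
      rw [h₁ t ht.1, h₂ t ht.1]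
      simp_rw [intervalIntegral.integral_sub (i1.intervalIntegrable _ _)
        (i2.intervalIntegrable _ _)]
      rw [intervalIntegral.integral_sub (p1.intervalIntegrable _ _) (p2.intervalIntegrable _ _)]
      ring
    have inner : ∀ r ∈ Set.uIoc 0 t,
        ‖∫ q in (0 : ℝ)..r, (dV (E₁ q) - dV (E₂ q))‖ ≤ L * f t := fun r hr => by
      rw [Set.uIoc_of_le ht.1] at hr
      have := intervalIntegral.norm_integral_le_of_norm_le (a := 0) (b := r) (μ := volume)
        (f := fun q => dV (E₁ q) - dV (E₂ q)) (g := fun q => L * D q) hr.1.le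
        (Eventually.of_forall fun q hq => hlip q ⟨hq.1.le, hq.2.trans (hr.2.trans ht.2)⟩)
        ((cD.const_mul _).intervalIntegrable _ _)
      rw [intervalIntegral.integral_const_mul] at this
      exact this.trans (mul_le_mul_of_nonneg_left (hfmono r t hr.1.le hr.2) hLT)
    have outer := intervalIntegral.norm_integral_le_of_norm_le_const inner
    rw [sub_zero, abs_of_nonneg ht.1] at outer
    simp only [hD]
    rw [e, abs_neg]
    refine (outer.trans (mul_le_mul_of_nonneg_left ht.2
      (mul_nonneg hLT (hf0 t ht.1)))).trans_eq (by ring)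
  -- Grönwall for `f = ∫ |E₁ - E₂|`: it vanishes at 0 and `f' ≤ T L f`.
  have hfT : f T = 0 := by
    refine eq_zero_of_abs_deriv_le_mul_abs_self_of_eq_zero_right (f' := D) (K := T * L)
      (a := 0) (b := T) ?_ ?_ ?_ ?_ T ⟨hT, le_rfl⟩
    · exact (intervalIntegral.continuous_primitive
        (fun _ _ => cD.intervalIntegrable _ _) 0).continuousOn
    · exact fun x _ => (intervalIntegral.integral_hasDerivAt_right (cD.intervalIntegrable _ _)
        (cD.stronglyMeasurableAtFilter _ _) cD.continuousAt).hasDerivWithinAt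
    · simp [hf]
    · intro x hx
      rw [Real.norm_of_nonneg (hD0 x), Real.norm_of_nonneg (hf0 x hx.1)]
      exact hbound x ⟨hx.1, hx.2.le⟩
  have := hbound T ⟨hT, le_rfl⟩
  rw [hfT, mul_zero] at this
  have h' : |E₁ T - E₂ T| = 0 := le_antisymm this (abs_nonneg _)
  exact sub_eq_zero.1 (abs_eq_zero.1 h')

/-- The right side of the integrated equation is a continuous representative of `H` on `t > 0`.
Replacing `H` by it under the integral changes nothing, so it solves the integrated equation
everywhere on `t ≥ 0`. -/
theorem IsGreenFunction.ae_eq {H₁ H₂ : ℝ → ℝ} (hdV : ContDiff ℝ 1 dV) (h0 : dV 0 = 0)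
    (g₁ : IsGreenFunction dV c H₁) (g₂ : IsGreenFunction dV c H₂)
    (n₁ : ∀ᵐ t, t < 0 → H₁ t = 0) (n₂ : ∀ᵐ t, t < 0 → H₂ t = 0) : H₁ =ᵐ[volume] H₂ := by
  have rep : ∀ {H : ℝ → ℝ}, IsGreenFunction dV c H → (∀ᵐ t, t < 0 → H t = 0) →
      ∃ E : ℝ → ℝ, Continuous E ∧ (∀ᵐ t, 0 < t → H t = E t) ∧
        ∀ t, 0 ≤ t → E t = c * t - ∫ r in (0 : ℝ)..t, ∫ q in (0 : ℝ)..r, dV (E q) := by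
    intro H g n
    have hae := g.ae_eq_integral h0 n
    refine ⟨fun t => c * t - ∫ r in (0 : ℝ)..t, ∫ q in (0 : ℝ)..r, dV (H q),
      (by fun_prop : Continuous fun t => c * t).sub (continuous_iterated_integral g.2), hae,
      fun t ht => ?_⟩
    simp only
    congr 1
    refine intervalIntegral.integral_congr fun r hr => ?_
    rw [Set.uIcc_of_le ht] at hr
    refine intervalIntegral.integral_congr_ae ?_
    filter_upwards [hae] with q hq hq'
    rw [Set.uIoc_of_le hr.1] at hq'
    exact congrArg dV (hq hq'.1)
  obtain ⟨E₁, c₁, a₁, e₁⟩ := rep g₁ n₁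
  obtain ⟨E₂, c₂, a₂, e₂⟩ := rep g₂ n₂
  have hne : ∀ᵐ t : ℝ, t ≠ 0 := by simp [ae_iff]
  filter_upwards [n₁, n₂, a₁, a₂, hne] with t n₁ n₂ a₁ a₂ hne
  rcases lt_or_gt_of_ne hne with h | h
  · rw [n₁ h, n₂ h]
  · rw [a₁ h, a₂ h, eq_of_integral_equation hdV c₁ c₂ e₁ e₂ h.le]

end GreenFunction

/-- The factor `(λ/2)^{1/4}`. -/
def rootScale (lam : ℝ) : ℝ := (lam / 2) ^ (1 / 4 : ℝ)

/-! ### The propagator: equation, uniqueness and sine series -/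

section Propagator

variable {lam Lam : ℝ}

theorem rootScale_pos (hlam : 0 < lam) : 0 < rootScale lam :=
  Real.rpow_pos_of_pos (by positivity) _

theorem rootScale_pow_four (hlam : 0 < lam) : rootScale lam ^ 4 = lam / 2 := by
  rw [rootScale, ← Real.rpow_natCast, ← Real.rpow_mul (by positivity)]
  norm_num

theorem rootScale_inv (hlam : 0 < lam) : (2 / lam) ^ (1 / 4 : ℝ) = (rootScale lam)⁻¹ := by
  rw [rootScale, ← Real.inv_rpow (by positivity), inv_div]

/-- The solution of the unforced cubic equation that equals the propagator for `t ≥ 0`. -/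
def oscillation (lam Lam t : ℝ) : ℝ := Lam * (rootScale lam)⁻¹ * snI (rootScale lam * Lam * t)

theorem propagator_eq_indicator (hlam : 0 < lam) :
    propagator lam Lam = (Set.Ici 0).indicator (oscillation lam Lam) := by
  ext t
  rw [propagator, rootScale_inv hlam, heaviside]
  by_cases ht : 0 ≤ t
  · rw [Set.indicator_of_mem (Set.mem_Ici.2 ht), if_pos ht, mul_one]; rfl
  · rw [Set.indicator_of_notMem (by simpa using ht), if_neg ht]; ring

theorem isGreenFunction_propagator (hlam : 0 < lam) :
    IsGreenFunction (fun x => lam * x ^ 3) (Lam ^ 2) (propagator lam Lam) := by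
  have hs := rootScale_pos hlam
  -- This relation turns the factor 2 of `sn'' = -2 sn³` into the coupling `λ`.
  have h4 : lam = 2 * rootScale lam ^ 4 := by rw [rootScale_pow_four hlam]; ring
  rw [propagator_eq_indicator hlam]
  have hlin : ∀ t, HasDerivAt (fun t => rootScale lam * Lam * t) (rootScale lam * Lam) t :=
    fun t => by simpa using (hasDerivAt_id t).const_mul (rootScale lam * Lam)
  refine isGreenFunction_indicator
    (g' := fun t => Lam ^ 2 * snDeriv (rootScale lam * Lam * t)) (by fun_prop) (by simp)
    (fun t => ?_) (fun t => ?_) (by simp [oscillation, snI_zero]) (by simp [snDeriv_zero])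
  · refine (((hasDerivAt_snI _).comp t (hlin t)).const_mul
      (Lam * (rootScale lam)⁻¹)).congr_deriv ?_
    field_simp
  · refine (((hasDerivAt_snDeriv _).comp t (hlin t)).const_mul (Lam ^ 2)).congr_deriv ?_
    simp only [oscillation]
    generalize snI (rootScale lam * Lam * t) = x
    generalize rootScale lam = s at *
    subst h4
    field_simp

theorem propagator_scaling (t : ℝ) (hLam : 0 < Lam) :
    propagator lam Lam t = Lam * propagator lam 1 (Lam * t) := by
  have hh : heaviside (Lam * t) = heaviside t := by
    simp only [heaviside, mul_nonneg_iff_of_pos_left hLam]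
  rw [propagator, propagator, hh]
  ring_nf

theorem propagator_of_neg {t : ℝ} (ht : t < 0) : propagator lam Lam t = 0 := by
  simp [propagator, heaviside, not_le.2 ht]

theorem contDiff_cubic : ContDiff ℝ 1 fun x : ℝ => lam * x ^ 3 := by fun_prop

theorem ae_eq_propagator (hlam : 0 < lam) {H : ℝ → ℝ}
    (hH : IsGreenFunction (fun x => lam * x ^ 3) (Lam ^ 2) H)
    (hneg : ∀ᵐ t, t < 0 → H t = 0) : H =ᵐ[volume] propagator lam Lam :=
  hH.ae_eq contDiff_cubic (by simp) (isGreenFunction_propagator hlam) hneg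
    (Eventually.of_forall fun _ => propagator_of_neg)

theorem ae_comp_neg {p : ℝ → Prop} (h : ∀ᵐ t, p t) : ∀ᵐ t, p (-t) :=
  (Measure.measurePreserving_neg (volume : Measure ℝ)).quasiMeasurePreserving.ae h

theorem ae_eq_propagator_neg (hlam : 0 < lam) {H : ℝ → ℝ}
    (hH : IsGreenFunction (fun x => lam * x ^ 3) (Lam ^ 2) H)
    (hpos : ∀ᵐ t, 0 < t → H t = 0) : H =ᵐ[volume] fun t => propagator lam Lam (-t) := by
  have h := ae_eq_propagator hlam hH.comp_neg (by
    filter_upwards [ae_comp_neg hpos] with t ht h'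
    exact ht (by linarith))
  filter_upwards [ae_comp_neg h] with t ht
  simpa using ht

theorem freq_eq (n : ℕ) : freq lam Lam n = (n + 1 / 2) * (Real.pi / KI) * rootScale lam * Lam := rfl

theorem freq_pos (hlam : 0 < lam) (hLam : 0 < Lam) (n : ℕ) : 0 < freq lam Lam n := by
  have h1 := rootScale_pos hlam
  have h2 := KI_pos
  have h3 := Real.pi_pos
  rw [freq_eq]
  positivity

theorem freq_zero_le (hlam : 0 < lam) (hLam : 0 < Lam) (n : ℕ) :
    freq lam Lam 0 ≤ freq lam Lam n := by
  have h1 := rootScale_pos hlam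
  have h2 := KI_pos
  have h3 := Real.pi_pos
  rw [freq_eq, freq_eq]
  gcongr
  simp

/-- The half-line transform of `sin(ω_n t)` is `-ω_n / (z² - ω_n²)`; written in this form, the
amplitude makes the numerator of the pole term equal to `Λ² B_n`. -/
theorem coeff_eq (hlam : 0 < lam) (hLam : 0 < Lam) (n : ℕ) :
    Lam * (rootScale lam)⁻¹ * snCoeff n = -(Lam ^ 2 * residueB n / freq lam Lam n) := by
  have h1 := rootScale_pos hlam
  have h2 := KI_pos
  have h3 := Real.pi_pos
  rw [freq_eq, snCoeff, residueB]
  field_simp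
  ring

theorem hasSum_oscillation (hlam : 0 < lam) (hLam : 0 < Lam) (t : ℝ) :
    HasSum (fun n => -(Lam ^ 2 * residueB n / freq lam Lam n) * Real.sin (freq lam Lam n * t))
      (oscillation lam Lam t) := by
  have h := (hasSum_snI (rootScale lam * Lam * t)).mul_left (Lam * (rootScale lam)⁻¹)
  refine h.congr_fun fun n => ?_
  rw [← mul_assoc, coeff_eq hlam hLam]
  congr 2
  have h2 := KI_pos
  rw [freq_eq]
  field_simp

theorem summable_coeff (hlam : 0 < lam) (hLam : 0 < Lam) :
    Summable fun n => |Lam ^ 2 * residueB n / freq lam Lam n| := by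
  refine (summable_abs_snCoeff.mul_left |Lam * (rootScale lam)⁻¹|).congr fun n => ?_
  rw [← abs_mul, coeff_eq hlam hLam, abs_neg]

theorem continuous_oscillation : Continuous (oscillation lam Lam) :=
  continuous_const.mul (continuous_snI.comp (by fun_prop))

theorem abs_oscillation_le (hlam : 0 < lam) (hLam : 0 < Lam) (t : ℝ) :
    |oscillation lam Lam t| ≤ Lam * (rootScale lam)⁻¹ := by
  have h1 := rootScale_pos hlam
  rw [oscillation, abs_mul, abs_of_pos (by positivity)]
  exact mul_le_of_le_one_right (by positivity) (abs_snI_le_one _)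

theorem measurable_propagator (hlam : 0 < lam) : Measurable (propagator lam Lam) := by
  rw [propagator_eq_indicator hlam]
  exact continuous_oscillation.measurable.indicator measurableSet_Ici

theorem abs_propagator_le (hlam : 0 < lam) (hLam : 0 < Lam) (t : ℝ) :
    |propagator lam Lam t| ≤ Lam * (rootScale lam)⁻¹ := by
  have h1 := rootScale_pos hlam
  rw [propagator_eq_indicator hlam]
  by_cases ht : t ∈ Set.Ici (0 : ℝ)
  · rw [Set.indicator_of_mem ht]
    exact abs_oscillation_le hlam hLam t
  · rw [Set.indicator_of_notMem ht, abs_zero]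
    positivity

/-- Integrals against the propagator are integrals over the half-line. -/
theorem integral_propagator_mul (hlam : 0 < lam) (f : ℝ → ℂ) :
    ∫ t, (propagator lam Lam t : ℂ) * f t
      = ∫ t in Set.Ioi (0 : ℝ), (oscillation lam Lam t : ℂ) * f t := by
  rw [← integral_Ici_eq_integral_Ioi, ← integral_indicator measurableSet_Ici,
    propagator_eq_indicator hlam]
  congr 1
  ext t
  by_cases ht : t ∈ Set.Ici (0 : ℝ)
  · rw [Set.indicator_of_mem ht, Set.indicator_of_mem ht]
  · rw [Set.indicator_of_notMem ht, Set.indicator_of_notMem ht]; simp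

/-- Termwise integration of the sine series of the propagator. -/
theorem hasSum_integral_propagator_mul (hlam : 0 < lam) (hLam : 0 < Lam) {f : ℝ → ℂ}
    (hf : IntegrableOn f (Set.Ioi 0)) :
    HasSum (fun n => -((Lam ^ 2 * residueB n / freq lam Lam n : ℝ) : ℂ) *
        ∫ t in Set.Ioi (0 : ℝ), (Real.sin (freq lam Lam n * t) : ℂ) * f t)
      (∫ t, (propagator lam Lam t : ℂ) * f t) := by
  rw [integral_propagator_mul hlam]
  simp_rw [← integral_const_mul]
  have hs := summable_coeff hlam hLam
  refine hasSum_integral_of_dominated_convergence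
    (fun n t => |Lam ^ 2 * residueB n / freq lam Lam n| * ‖f t‖) (fun n => ?_) (fun n => ?_)
    ?_ ?_ ?_
  · exact ((by fun_prop : Continuous fun t : ℝ =>
      (Real.sin (freq lam Lam n * t) : ℂ)).aestronglyMeasurable.mul
        hf.aestronglyMeasurable).const_mul _
  · refine Eventually.of_forall fun t => ?_
    rw [norm_mul, norm_mul, norm_neg, Complex.norm_real, Complex.norm_real, Real.norm_eq_abs,
      Real.norm_eq_abs]
    refine mul_le_mul_of_nonneg_left ?_ (abs_nonneg _)
    exact mul_le_of_le_one_left (norm_nonneg _) (Real.abs_sin_le_one _)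
  · exact Eventually.of_forall fun t => hs.mul_right _
  · simp_rw [tsum_mul_right]
    exact hf.norm.const_mul _
  · refine Eventually.of_forall fun t => ?_
    have := ((Complex.hasSum_ofReal.2 (hasSum_oscillation hlam hLam t)).mul_right (f t))
    refine this.congr_fun fun n => ?_
    push_cast
    ring

end Propagator

/-! ### Transforms of Schwartz functions with kernel `e^{iωt}` -/

section TestFunctions

/-- The transform `∫ e^{iωt} ψ(ω) dω` of a test function. -/
def testHat (ψ : 𝓢(ℝ, ℂ)) (t : ℝ) : ℂ := ∫ ω : ℝ, Complex.exp (Complex.I * ω * t) * ψ ω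

theorem norm_exp_I_mul_mul (ω t : ℝ) : ‖Complex.exp (Complex.I * ω * t)‖ = 1 := by
  rw [show Complex.I * ω * t = ((ω * t : ℝ) : ℂ) * Complex.I by push_cast; ring,
    Complex.norm_exp_ofReal_mul_I]

open FourierTransform in
theorem testHat_eq_fourier (ψ : 𝓢(ℝ, ℂ)) (t : ℝ) :
    testHat ψ t = (𝓕 ψ : 𝓢(ℝ, ℂ)) (-(2 * Real.pi)⁻¹ * t) := by
  rw [SchwartzMap.fourier_coe, Real.fourier_eq', testHat]
  congr 1
  ext ω
  rw [smul_eq_mul]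
  congr 2
  have : (Real.pi : ℂ) ≠ 0 := by exact_mod_cast Real.pi_ne_zero
  simp only [RCLike.inner_apply, conj_trivial]
  push_cast
  field_simp

theorem two_pi_inv_ne_zero : -(2 * Real.pi)⁻¹ ≠ 0 :=
  neg_ne_zero.2 (inv_ne_zero (by positivity))

open FourierTransform in
theorem integrable_testHat (ψ : 𝓢(ℝ, ℂ)) : Integrable (testHat ψ) := by
  rw [show testHat ψ = fun t => (𝓕 ψ : 𝓢(ℝ, ℂ)) (-(2 * Real.pi)⁻¹ * t) from
    funext (testHat_eq_fourier ψ)]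
  exact (SchwartzMap.integrable _).comp_mul_left' two_pi_inv_ne_zero

open FourierTransform in
-- Fourier inversion, rescaled. It is used to see that a pure exponential `e^{iat}` is invisible to
-- a test function vanishing at `-a`.
theorem integral_exp_mul_testHat (ψ : 𝓢(ℝ, ℂ)) (a : ℝ) :
    ∫ t : ℝ, Complex.exp (Complex.I * a * t) * testHat ψ t = 2 * Real.pi * ψ (-a) := by
  have hpi : (Real.pi : ℂ) ≠ 0 := by exact_mod_cast Real.pi_ne_zero
  have hinv : ψ (-a) = ∫ v : ℝ, Complex.exp (-(2 * Real.pi * Complex.I * a * v)) *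
      (𝓕 ψ : 𝓢(ℝ, ℂ)) v := by
    conv_lhs => rw [← FourierTransform.fourierInv_fourier_eq (F := 𝓢(ℝ, ℂ)) ψ]
    rw [SchwartzMap.fourierInv_coe, Real.fourierInv_eq']
    congr 1
    ext v
    rw [smul_eq_mul]
    congr 2
    simp only [RCLike.inner_apply, conj_trivial]
    push_cast
    ring
  have h := Measure.integral_comp_mul_left (fun v : ℝ =>
    Complex.exp (-(2 * Real.pi * Complex.I * a * v)) * (𝓕 ψ : 𝓢(ℝ, ℂ)) v) (-(2 * Real.pi)⁻¹)
  rw [← hinv, inv_neg, inv_inv, abs_neg, abs_of_pos (by positivity : 0 < 2 * Real.pi)] at h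
  rw [Complex.real_smul] at h
  push_cast at h
  rw [← h]
  congr 1
  ext t
  rw [testHat_eq_fourier]
  congr 2
  field_simp

theorem fourierPairing_eq (f : ℝ → ℝ) (ψ : 𝓢(ℝ, ℂ)) :
    fourierPairing f ψ = ∫ t, (f t : ℂ) * testHat ψ t := rfl

/-- Fubini: pairing the transform of an integrable kernel with a test function. -/
theorem integral_transform_mul {k : ℝ → ℂ} (hk : Integrable k) (ψ : 𝓢(ℝ, ℂ)) :
    ∫ ω : ℝ, (∫ t : ℝ, k t * Complex.exp (Complex.I * ω * t)) * ψ ω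
      = ∫ t : ℝ, k t * testHat ψ t := by
  simp only [testHat, ← integral_const_mul, ← integral_mul_const]
  rw [integral_integral_swap]
  · congr 1
    ext t
    congr 1
    ext ω
    ring
  · have h := (ψ.integrable (μ := volume)).mul_prod hk
    refine Integrable.congr (h.bdd_mul (f := fun p : ℝ × ℝ =>
      Complex.exp (Complex.I * p.1 * p.2)) (c := 1) ?_ ?_) ?_
    · exact (by fun_prop : Continuous fun p : ℝ × ℝ =>
        Complex.exp (Complex.I * p.1 * p.2)).aestronglyMeasurable
    · exact Eventually.of_forall fun p => (norm_exp_I_mul_mul _ _).le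
    · refine Eventually.of_forall fun p => ?_
      simp only [Function.uncurry]
      ring

/-- The reflection `ω ↦ ψ(-ω)` of a test function. -/
def reflectTest (ψ : 𝓢(ℝ, ℂ)) : 𝓢(ℝ, ℂ) :=
  SchwartzMap.compCLMOfContinuousLinearEquiv ℂ (ContinuousLinearEquiv.neg ℝ) ψ

theorem reflectTest_apply (ψ : 𝓢(ℝ, ℂ)) (ω : ℝ) : reflectTest ψ ω = ψ (-ω) := rfl

theorem testHat_reflectTest (ψ : 𝓢(ℝ, ℂ)) (t : ℝ) : testHat (reflectTest ψ) t = testHat ψ (-t) := by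
  rw [testHat, testHat, ← integral_neg_eq_self]
  simp [reflectTest_apply]

theorem fourierPairing_comp_neg (f : ℝ → ℝ) (ψ : 𝓢(ℝ, ℂ)) :
    fourierPairing (fun t => f (-t)) ψ = fourierPairing f (reflectTest ψ) := by
  rw [fourierPairing_eq, fourierPairing_eq, ← integral_neg_eq_self]
  simp [testHat_reflectTest]

end TestFunctions

/-! ### The retarded transform, `ω` replaced by `ω + i0` -/

section Transform

variable {lam Lam : ℝ}

theorem exp_I_mul_add (ω ε t : ℝ) : Complex.exp (Complex.I * (ω + Complex.I * ε) * t)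
    = Complex.exp (-(ε : ℂ) * t) * Complex.exp (Complex.I * ω * t) := by
  rw [← Complex.exp_add]
  congr 1
  linear_combination (ε * t : ℂ) * Complex.I_sq

/-- The sine is a combination of two exponentials, and `Im z = ε > 0` makes both products with
`e^{izt}` decay. -/
theorem integral_sin_mul_exp (a ω : ℝ) {ε : ℝ} (hε : 0 < ε) :
    ∫ t in Set.Ioi (0 : ℝ), (Real.sin (a * t) : ℂ) *
        Complex.exp (Complex.I * (ω + Complex.I * ε) * t)
      = -(a / ((ω + Complex.I * ε) ^ 2 - (a : ℂ) ^ 2)) := by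
  set z : ℂ := ω + Complex.I * ε with hz
  have hzim : z.im = ε := by simp [hz]
  have hre : ∀ b : ℝ, (Complex.I * (z + b)).re < 0 := fun b => by
    simp only [Complex.mul_re, Complex.I_re, Complex.I_im, Complex.add_im, Complex.ofReal_im, hzim]
    linarith
  have hne : ∀ b : ℝ, z + b ≠ 0 := fun b h => by
    have := hre b
    rw [h] at this
    simp at this
  have hform : ∀ t : ℝ, (Real.sin (a * t) : ℂ) * Complex.exp (Complex.I * z * t)
      = Complex.I / 2 * (Complex.exp (Complex.I * (z + (-a : ℝ)) * t)
        - Complex.exp (Complex.I * (z + a) * t)) := fun t => by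
    rw [Complex.ofReal_sin, Complex.sin]
    have e1 : Complex.exp (Complex.I * (z + (-a : ℝ)) * t)
        = Complex.exp (-((a * t : ℝ) : ℂ) * Complex.I) * Complex.exp (Complex.I * z * t) := by
      rw [← Complex.exp_add]; congr 1; push_cast; ring
    have e2 : Complex.exp (Complex.I * (z + a) * t)
        = Complex.exp (((a * t : ℝ) : ℂ) * Complex.I) * Complex.exp (Complex.I * z * t) := by
      rw [← Complex.exp_add]; congr 1; push_cast; ring
    rw [e1, e2]
    ring
  simp only [hform]
  rw [integral_const_mul, integral_sub (integrableOn_exp_mul_complex_Ioi (hre (-a)) 0)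
    (integrableOn_exp_mul_complex_Ioi (hre a) 0), integral_exp_mul_complex_Ioi (hre (-a)),
    integral_exp_mul_complex_Ioi (hre a)]
  have h1 := hne a
  have h2 := hne (-a)
  have h3 : z ^ 2 - (a : ℂ) ^ 2 ≠ 0 := by
    rw [show z ^ 2 - (a : ℂ) ^ 2 = (z + a) * (z + (-a : ℝ)) by push_cast; ring]
    exact mul_ne_zero h1 h2
  have hI := Complex.I_ne_zero
  simp only [Complex.ofReal_zero, mul_zero, Complex.exp_zero]
  field_simp
  push_cast
  ring

theorem integrableOn_exp_frequency (ω : ℝ) {ε : ℝ} (hε : 0 < ε) :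
    IntegrableOn (fun t : ℝ => Complex.exp (Complex.I * (ω + Complex.I * ε) * t))
      (Set.Ioi 0) :=
  integrableOn_exp_mul_complex_Ioi (by simpa using hε) 0

theorem integrable_propagator_mul (hlam : 0 < lam) (hLam : 0 < Lam) {f : ℝ → ℂ}
    (hf : IntegrableOn f (Set.Ioi 0)) :
    Integrable fun t => (propagator lam Lam t : ℂ) * f t := by
  have h1 : Integrable ((Set.Ioi 0).indicator f) :=
    (integrable_indicator_iff measurableSet_Ioi).2 hf
  have h2 := h1.bdd_mul (f := fun t => (propagator lam Lam t : ℂ))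
    (c := Lam * (rootScale lam)⁻¹)
    (Complex.measurable_ofReal.comp (measurable_propagator hlam)).aestronglyMeasurable
    (Eventually.of_forall fun t => by
      rw [Complex.norm_real]; exact abs_propagator_le hlam hLam t)
  refine h2.congr ?_
  have hne : ∀ᵐ t : ℝ, t ≠ 0 := by simp [ae_iff]
  filter_upwards [hne] with t hne
  rcases lt_or_gt_of_ne hne with h | h
  · rw [propagator_of_neg h]; simp
  · rw [Set.indicator_of_mem (Set.mem_Ioi.2 h)]

theorem hasSum_transform (hlam : 0 < lam) (hLam : 0 < Lam) (ω : ℝ) {ε : ℝ} (hε : 0 < ε) :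
    HasSum (fun n => (Lam : ℂ) ^ 2 * poleTerm lam Lam ((ω + Complex.I * ε) ^ 2) n)
      (∫ t : ℝ, (propagator lam Lam t : ℂ) *
        Complex.exp (Complex.I * (ω + Complex.I * ε) * t)) := by
  refine (hasSum_integral_propagator_mul hlam hLam
    (integrableOn_exp_frequency ω hε)).congr_fun fun n => ?_
  have ha := freq_pos hlam hLam n
  have ha' : (freq lam Lam n : ℂ) ≠ 0 := by exact_mod_cast ha.ne'
  rw [integral_sin_mul_exp _ _ hε, poleTerm]
  push_cast
  field_simp

/-- Fubini moves the transform onto `ψ` and leaves `ε` only in the damping `e^{-εt}`. This is at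
most 1 where the propagator is nonzero, so the integrable transform of `ψ`, times the bound of the
propagator, dominates. -/
theorem tendsto_poleSum_retarded (hlam : 0 < lam) (hLam : 0 < Lam) (ψ : 𝓢(ℝ, ℂ)) :
    Tendsto (fun ε : ℝ => ∫ ω : ℝ,
        (Lam : ℂ) ^ 2 * poleSum lam Lam ((ω + Complex.I * ε) ^ 2) * ψ ω)
      (𝓝[>] 0) (𝓝 (fourierPairing (propagator lam Lam) ψ)) := by
  have key : ∀ ε : ℝ, 0 < ε → ∫ ω : ℝ,
      (Lam : ℂ) ^ 2 * poleSum lam Lam ((ω + Complex.I * ε) ^ 2) * ψ ω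
      = ∫ t : ℝ, (propagator lam Lam t : ℂ) * Complex.exp (-(ε : ℂ) * t) * testHat ψ t := by
    intro ε hε
    have hk : Integrable fun t : ℝ =>
        (propagator lam Lam t : ℂ) * Complex.exp (-(ε : ℂ) * t) :=
      integrable_propagator_mul hlam hLam
        (integrableOn_exp_mul_complex_Ioi (by simpa using hε) 0)
    rw [← integral_transform_mul hk]
    congr 1
    ext ω
    congr 1
    have := (hasSum_transform hlam hLam ω hε).tsum_eq
    rw [tsum_mul_left] at this
    rw [poleSum, this]
    congr 1
    ext t
    rw [exp_I_mul_add]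
    ring
  rw [fourierPairing_eq]
  have hG := Complex.measurable_ofReal.comp (measurable_propagator (Lam := Lam) hlam)
  have hlim : Tendsto (fun ε : ℝ => ∫ t : ℝ, (propagator lam Lam t : ℂ) *
      Complex.exp (-(ε : ℂ) * t) * testHat ψ t) (𝓝[>] 0)
      (𝓝 (∫ t, (propagator lam Lam t : ℂ) * testHat ψ t)) := by
    refine tendsto_integral_filter_of_dominated_convergence
      (fun t => Lam * (rootScale lam)⁻¹ * ‖testHat ψ t‖) ?_ ?_
      ((integrable_testHat ψ).norm.const_mul _) ?_
    · refine Eventually.of_forall fun ε => ?_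
      exact (hG.aestronglyMeasurable.mul (by fun_prop : Continuous fun t : ℝ =>
        Complex.exp (-(ε : ℂ) * t)).aestronglyMeasurable).mul
          (integrable_testHat ψ).aestronglyMeasurable
    · filter_upwards [self_mem_nhdsWithin] with ε hε
      refine Eventually.of_forall fun t => ?_
      rw [norm_mul]
      refine mul_le_mul_of_nonneg_right ?_ (norm_nonneg _)
      rcases lt_or_ge t 0 with h | h
      · rw [propagator_of_neg h]
        have := rootScale_pos hlam
        simp
        positivity
      · rw [norm_mul, Complex.norm_real, Complex.norm_exp]
        refine (mul_le_of_le_one_right (norm_nonneg _) (Real.exp_le_one_iff.2 ?_)).trans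
          (abs_propagator_le hlam hLam t)
        have : 0 ≤ ε * t := mul_nonneg (le_of_lt hε) h
        simpa using this
    · refine Eventually.of_forall fun t => ?_
      have hc : Continuous fun ε : ℝ =>
          (propagator lam Lam t : ℂ) * Complex.exp (-(ε : ℂ) * t) * testHat ψ t := by fun_prop
      have := (hc.tendsto 0).mono_left (nhdsWithin_le_nhds (s := Set.Ioi 0))
      simpa using this
  refine hlim.congr' ?_
  filter_upwards [self_mem_nhdsWithin] with ε hε using (key ε hε).symm

end Transform

/-! ### The prescription `ω² + iε` -/

section TimeOrdered

variable {lam Lam : ℝ}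

/-- Take the root in the lower half-plane. From `2 Re c · Im c = -ε` its real part is positive, so
`|c + a| ≥ a`, and `(c - a)(c + a) = -iε` gives the distance to `a`. The lower bound on `|c|` holds
because `|c|² = |a² - iε| ≥ a²`. -/
theorem exists_sqrt_sub_I_mul {a ε : ℝ} (ha : 0 < a) (hε : 0 < ε) :
    ∃ c : ℂ, c ^ 2 = (a : ℂ) ^ 2 - Complex.I * ε ∧ c.im < 0 ∧ a ≤ ‖c‖ ∧ ‖c - a‖ ≤ ε / a := by
  obtain ⟨c, hc, him⟩ : ∃ c : ℂ, c ^ 2 = (a : ℂ) ^ 2 - Complex.I * ε ∧ c.im ≤ 0 := by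
    obtain ⟨d, hd⟩ := IsAlgClosed.exists_pow_nat_eq ((a : ℂ) ^ 2 - Complex.I * ε)
      (n := 2) (by norm_num)
    rcases le_total d.im 0 with h | h
    · exact ⟨d, hd, h⟩
    · exact ⟨-d, by rw [neg_sq, hd], by simpa using h⟩
  have e1 : 2 * (c.re * c.im) = -ε := by
    have := congrArg Complex.im hc
    rw [pow_two] at this
    simp [pow_two] at this
    linarith
  have him' : c.im < 0 := lt_of_le_of_ne him fun h => by rw [h] at e1; simp at e1; linarith
  have hre : 0 < c.re := by
    by_contra h
    nlinarith [mul_nonneg_of_nonpos_of_nonpos (not_lt.1 h) him]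
  refine ⟨c, hc, him', ?_, ?_⟩
  · have h2 : a ^ 2 ≤ ‖c‖ ^ 2 := by
      rw [← norm_pow, hc]
      refine le_trans ?_ (Complex.re_le_norm _)
      simp [pow_two]
    exact le_of_sq_le_sq h2 (norm_nonneg _)
  · have h3 : a ≤ ‖c + a‖ := by
      refine le_trans ?_ (Complex.re_le_norm _)
      simpa using hre.le
    have h4 : ‖c - a‖ * ‖c + a‖ = ε := by
      rw [← norm_mul, show (c - a) * (c + a) = c ^ 2 - (a : ℂ) ^ 2 by ring, hc,
        show (a : ℂ) ^ 2 - Complex.I * ε - (a : ℂ) ^ 2 = -(Complex.I * ε) by ring, norm_neg,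
        norm_mul, Complex.norm_I, one_mul, Complex.norm_real, Real.norm_of_nonneg hε.le]
    rw [le_div_iff₀ ha, ← h4]
    exact mul_le_mul_of_nonneg_left h3 (norm_nonneg _)

/-- The time-ordered kernel with frequency `c`. -/
def orderedKernel (c : ℂ) (t : ℝ) : ℂ :=
  -Complex.I / (2 * c) * Complex.exp (-(Complex.I * c * |t|))

theorem continuous_orderedKernel (c : ℂ) : Continuous (orderedKernel c) := by
  unfold orderedKernel
  have : Continuous fun t : ℝ => ((|t| : ℝ) : ℂ) := Complex.continuous_ofReal.comp continuous_abs
  fun_prop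

theorem norm_orderedKernel_le {c : ℂ} (hc : c.im ≤ 0) {a : ℝ} (ha : 0 < a) (hac : a ≤ ‖c‖)
    (t : ℝ) : ‖orderedKernel c t‖ ≤ 1 / (2 * a) := by
  rw [orderedKernel, norm_mul, norm_div, norm_neg, Complex.norm_I, norm_mul, Complex.norm_ofNat,
    Complex.norm_exp]
  have h1 : (-(Complex.I * c * |t|)).re ≤ 0 := by
    simpa using mul_nonpos_of_nonpos_of_nonneg hc (abs_nonneg t)
  refine (mul_le_of_le_one_right (by positivity) (Real.exp_le_one_iff.2 h1)).trans ?_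
  gcongr

/-- Split at `t = 0`: `Im c < 0` makes `e^{i(ω - c)t}` decay on the right and `e^{i(ω + c)t}` on the
left. Partial fractions recombine the two integrals. -/
theorem orderedKernel_transform_aux {c : ℂ} (hc : c.im < 0) (ω : ℝ) :
    IntegrableOn (fun t : ℝ => orderedKernel c t * Complex.exp (Complex.I * ω * t))
      (Set.Iic 0) ∧
    IntegrableOn (fun t : ℝ => orderedKernel c t * Complex.exp (Complex.I * ω * t))
      (Set.Ioi 0) ∧
    ∫ t : ℝ, orderedKernel c t * Complex.exp (Complex.I * ω * t) = 1 / ((ω : ℂ) ^ 2 - c ^ 2) := by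
  have hc0 : c ≠ 0 := fun h => by rw [h] at hc; simp at hc
  have hr1 : (Complex.I * (ω - c)).re < 0 := by simpa using hc
  have hr2 : 0 < (Complex.I * (ω + c)).re := by simpa using hc
  have e1 : ∀ t ∈ Set.Ioi (0 : ℝ), orderedKernel c t * Complex.exp (Complex.I * ω * t)
      = -Complex.I / (2 * c) * Complex.exp (Complex.I * (ω - c) * t) := fun t ht => by
    rw [orderedKernel, abs_of_pos ht, mul_assoc, ← Complex.exp_add]
    ring_nf
  have e2 : ∀ t ∈ Set.Iic (0 : ℝ), orderedKernel c t * Complex.exp (Complex.I * ω * t)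
      = -Complex.I / (2 * c) * Complex.exp (Complex.I * (ω + c) * t) := fun t ht => by
    rw [orderedKernel, abs_of_nonpos ht, mul_assoc, ← Complex.exp_add]
    push_cast
    ring_nf
  have i1 := IntegrableOn.congr_fun ((integrableOn_exp_mul_complex_Ioi hr1 0).const_mul
    (-Complex.I / (2 * c))) (fun t ht => (e1 t ht).symm) measurableSet_Ioi
  have i2 := IntegrableOn.congr_fun ((integrableOn_exp_mul_complex_Iic hr2 0).const_mul
    (-Complex.I / (2 * c))) (fun t ht => (e2 t ht).symm) measurableSet_Iic
  refine ⟨i2, i1, ?_⟩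
  rw [← intervalIntegral.integral_Iic_add_Ioi i2 i1, setIntegral_congr_fun measurableSet_Ioi e1,
    setIntegral_congr_fun measurableSet_Iic e2, integral_const_mul, integral_const_mul,
    integral_exp_mul_complex_Ioi hr1, integral_exp_mul_complex_Iic hr2]
  have h1 : (ω : ℂ) - c ≠ 0 := fun h => by rw [h] at hr1; simp at hr1
  have h2 : (ω : ℂ) + c ≠ 0 := fun h => by rw [h] at hr2; simp at hr2
  have h3 : (ω : ℂ) ^ 2 - c ^ 2 ≠ 0 := by
    rw [sq_sub_sq]; exact mul_ne_zero h2 h1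
  have hI := Complex.I_ne_zero
  simp only [Complex.ofReal_zero, mul_zero, Complex.exp_zero]
  field_simp
  ring

theorem integral_orderedKernel_mul_exp {c : ℂ} (hc : c.im < 0) (ω : ℝ) :
    ∫ t : ℝ, orderedKernel c t * Complex.exp (Complex.I * ω * t) = 1 / ((ω : ℂ) ^ 2 - c ^ 2) :=
  (orderedKernel_transform_aux hc ω).2.2

theorem integrable_orderedKernel {c : ℂ} (hc : c.im < 0) : Integrable (orderedKernel c) := by
  obtain ⟨h1, h2, -⟩ := orderedKernel_transform_aux hc 0
  simpa using h1.union h2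

theorem integral_pole_mul_test {c : ℂ} (hc : c.im < 0) (ψ : 𝓢(ℝ, ℂ)) :
    ∫ ω : ℝ, 1 / ((ω : ℂ) ^ 2 - c ^ 2) * ψ ω = ∫ t : ℝ, orderedKernel c t * testHat ψ t := by
  rw [← integral_transform_mul (integrable_orderedKernel hc)]
  simp only [integral_orderedKernel_mul_exp hc]

theorem norm_integral_orderedKernel_le {c : ℂ} (hc : c.im ≤ 0) {a : ℝ} (ha : 0 < a)
    (hac : a ≤ ‖c‖) (ψ : 𝓢(ℝ, ℂ)) :
    ‖∫ t : ℝ, orderedKernel c t * testHat ψ t‖ ≤ 1 / (2 * a) * ∫ t : ℝ, ‖testHat ψ t‖ := by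
  rw [← integral_const_mul]
  refine norm_integral_le_of_norm_le ((integrable_testHat ψ).norm.const_mul _)
    (Eventually.of_forall fun t => ?_)
  rw [norm_mul]
  exact mul_le_mul_of_nonneg_right (norm_orderedKernel_le hc ha hac t) (norm_nonneg _)

theorem tendsto_integral_orderedKernel {a : ℝ} (ha : 0 < a) {c : ℝ → ℂ}
    (hc : ∀ ε, 0 < ε → (c ε).im < 0 ∧ a ≤ ‖c ε‖ ∧ ‖c ε - a‖ ≤ ε / a) (ψ : 𝓢(ℝ, ℂ)) :
    Tendsto (fun ε => ∫ t : ℝ, orderedKernel (c ε) t * testHat ψ t) (𝓝[>] 0)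
      (𝓝 (∫ t : ℝ, orderedKernel a t * testHat ψ t)) := by
  have hlim : Tendsto c (𝓝[>] 0) (𝓝 (a : ℂ)) := by
    rw [tendsto_iff_norm_sub_tendsto_zero]
    have h0 : Tendsto (fun ε : ℝ => ε / a) (𝓝[>] 0) (𝓝 0) := by
      have := ((continuous_id.div_const a).tendsto 0).mono_left
        (nhdsWithin_le_nhds (s := Set.Ioi 0))
      simpa using this
    refine squeeze_zero' (Eventually.of_forall fun _ => norm_nonneg _) ?_ h0
    filter_upwards [self_mem_nhdsWithin] with ε hε using (hc ε hε).2.2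
  refine tendsto_integral_filter_of_dominated_convergence
    (fun t => 1 / (2 * a) * ‖testHat ψ t‖) ?_ ?_ ((integrable_testHat ψ).norm.const_mul _) ?_
  · exact Eventually.of_forall fun ε => (continuous_orderedKernel _).aestronglyMeasurable.mul
      (integrable_testHat ψ).aestronglyMeasurable
  · filter_upwards [self_mem_nhdsWithin] with ε hε
    refine Eventually.of_forall fun t => ?_
    rw [norm_mul]
    exact mul_le_mul_of_nonneg_right
      (norm_orderedKernel_le (hc ε hε).1.le ha (hc ε hε).2.1 t) (norm_nonneg _)
  · refine Eventually.of_forall fun t => ?_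
    have ha' : (2 * (a : ℂ)) ≠ 0 := by
      have : (a : ℂ) ≠ 0 := by exact_mod_cast ha.ne'
      simpa using this
    have hk : Tendsto (fun c : ℂ => orderedKernel c t) (𝓝 (a : ℂ)) (𝓝 (orderedKernel a t)) := by
      unfold orderedKernel
      refine ContinuousAt.tendsto (ContinuousAt.mul (ContinuousAt.div ?_ ?_ ha') ?_) <;> fun_prop
    exact (hk.comp hlim).mul_const _

/-- For a test function vanishing at `-a`, the time-ordered kernel and the retarded kernel
have the same pairing. -/
theorem integral_orderedKernel_ofReal {a : ℝ} (ha : 0 < a) (ψ : 𝓢(ℝ, ℂ)) (hψ : ψ (-a) = 0) :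
    ∫ t : ℝ, orderedKernel a t * testHat ψ t
      = -(1 / a) * ∫ t in Set.Ioi (0 : ℝ), (Real.sin (a * t) : ℂ) * testHat ψ t := by
  have hinv := integral_exp_mul_testHat ψ a
  rw [hψ, mul_zero] at hinv
  have ha' : (a : ℂ) ≠ 0 := by exact_mod_cast ha.ne'
  have hfi := integrable_testHat ψ
  have i0 : Integrable fun t : ℝ => Complex.exp (Complex.I * a * t) * testHat ψ t :=
    hfi.bdd_mul (c := 1) (by fun_prop : Continuous fun t : ℝ =>
      Complex.exp (Complex.I * a * t)).aestronglyMeasurable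
      (Eventually.of_forall fun t => (norm_exp_I_mul_mul _ _).le)
  have i1 : Integrable fun t : ℝ => (Real.sin (a * t) : ℂ) * testHat ψ t :=
    hfi.bdd_mul (c := 1) (by fun_prop : Continuous fun t : ℝ =>
      (Real.sin (a * t) : ℂ)).aestronglyMeasurable
      (Eventually.of_forall fun t => by
        rw [Complex.norm_real]; exact Real.abs_sin_le_one _)
  -- This is `e^{-ia|t|} = e^{iat} - 2i θ(t) sin(at)`; the first term integrates to a multiple of
  -- `ψ(-a) = 0`.
  have hsplit : ∀ t : ℝ, orderedKernel a t * testHat ψ t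
      = -Complex.I / (2 * a) * (Complex.exp (Complex.I * a * t) * testHat ψ t)
        + (Set.Ioi 0).indicator
          (fun t => -(1 / (a : ℂ)) * ((Real.sin (a * t) : ℂ) * testHat ψ t)) t := fun t => by
    rcases le_or_gt t 0 with h | h
    · rw [Set.indicator_of_notMem (by simpa using h), orderedKernel, abs_of_nonpos h, add_zero]
      push_cast
      ring_nf
    · rw [Set.indicator_of_mem (Set.mem_Ioi.2 h), orderedKernel, abs_of_pos h,
        Complex.ofReal_sin, Complex.sin]
      have e1 : ((a * t : ℝ) : ℂ) * Complex.I = Complex.I * a * t := by push_cast; ring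
      have e2 : -((a * t : ℝ) : ℂ) * Complex.I = -(Complex.I * a * t) := by push_cast; ring
      rw [e1, e2]
      field_simp
      ring
  simp only [hsplit]
  rw [integral_add (i0.const_mul _)
    ((integrable_indicator_iff measurableSet_Ioi).2 (i1.integrableOn.const_mul _)),
    integral_const_mul, hinv, mul_zero, zero_add, integral_indicator measurableSet_Ioi,
    integral_const_mul]

theorem norm_pole_le (w : ℂ) {x ε : ℝ} (hε : 0 < ε) (hw : w.im = ε) : ‖w - (x : ℂ) ^ 2‖⁻¹ ≤ ε⁻¹ := by
  refine inv_anti₀ hε ?_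
  have := Complex.abs_im_le_norm (w - (x : ℂ) ^ 2)
  rw [Complex.sub_im, hw, ← Complex.ofReal_pow, Complex.ofReal_im, sub_zero,
    abs_of_pos hε] at this
  rwa [← Complex.ofReal_pow]

theorem im_sq_add_I_mul (ω ε : ℝ) : ((ω : ℂ) ^ 2 + Complex.I * ε).im = ε := by
  rw [← Complex.ofReal_pow, Complex.add_im, Complex.ofReal_im]; simp

theorem norm_poleTerm_le (ω : ℝ) {ε : ℝ} (hε : 0 < ε) (n : ℕ) :
    ‖poleTerm lam Lam ((ω : ℂ) ^ 2 + Complex.I * ε) n‖ ≤ |residueB n| * ε⁻¹ := by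
  rw [poleTerm, norm_div, Complex.norm_real, Real.norm_eq_abs, div_eq_mul_inv]
  exact mul_le_mul_of_nonneg_left (norm_pole_le _ hε (im_sq_add_I_mul ω ε)) (abs_nonneg _)

theorem summable_poleTerm (ω : ℝ) {ε : ℝ} (hε : 0 < ε) :
    Summable (poleTerm lam Lam ((ω : ℂ) ^ 2 + Complex.I * ε)) :=
  Summable.of_norm_bounded (summable_abs_residueB.mul_right _) (norm_poleTerm_le ω hε)

theorem hasSum_integral_poleTerm {ε : ℝ} (hε : 0 < ε) (ψ : 𝓢(ℝ, ℂ)) :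
    HasSum (fun n => ∫ ω : ℝ,
        (Lam : ℂ) ^ 2 * poleTerm lam Lam ((ω : ℂ) ^ 2 + Complex.I * ε) n * ψ ω)
      (∫ ω : ℝ, (Lam : ℂ) ^ 2 * poleSum lam Lam ((ω : ℂ) ^ 2 + Complex.I * ε) * ψ ω) := by
  have hs := ((summable_abs_residueB.mul_right ε⁻¹).mul_left ‖(Lam : ℂ) ^ 2‖)
  have hi := ψ.integrable (μ := volume)
  refine hasSum_integral_of_dominated_convergence
    (fun n ω => ‖(Lam : ℂ) ^ 2‖ * (|residueB n| * ε⁻¹) * ‖ψ ω‖) (fun n => ?_) (fun n => ?_) ?_ ?_ ?_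
  · refine AEStronglyMeasurable.mul ?_ hi.aestronglyMeasurable
    have : Measurable fun ω : ℝ =>
        (Lam : ℂ) ^ 2 * poleTerm lam Lam ((ω : ℂ) ^ 2 + Complex.I * ε) n := by
      unfold poleTerm
      fun_prop
    exact this.aestronglyMeasurable
  · refine Eventually.of_forall fun ω => ?_
    rw [norm_mul, norm_mul]
    gcongr
    exact norm_poleTerm_le ω hε n
  · exact Eventually.of_forall fun ω => hs.mul_right _
  · simp_rw [tsum_mul_right]
    exact hi.norm.const_mul _
  · exact Eventually.of_forall fun ω => ((summable_poleTerm ω hε).hasSum.mul_left _).mul_right _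

/-- All the points `-ω_n` lie outside the support of `ψ`, so each limiting time-ordered kernel may
be replaced by the retarded one. Limit and sum commute by dominated convergence for series. -/
theorem tendsto_poleSum_ordered (hlam : 0 < lam) (hLam : 0 < Lam) (ψ : 𝓢(ℝ, ℂ))
    (hψ : tsupport ψ ⊆ Set.Ioi (-freq lam Lam 0)) :
    Tendsto (fun ε : ℝ => ∫ ω : ℝ,
        (Lam : ℂ) ^ 2 * poleSum lam Lam ((ω : ℂ) ^ 2 + Complex.I * ε) * ψ ω)
      (𝓝[>] 0) (𝓝 (fourierPairing (propagator lam Lam) ψ)) := by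
  have hpos := freq_pos hlam hLam
  have hzero : ∀ n, ψ (-freq lam Lam n) = 0 := fun n => by
    by_contra h
    have := hψ (subset_tsupport _ h)
    rw [Set.mem_Ioi] at this
    linarith [freq_zero_le hlam hLam n]
  choose! c hc using fun (n : ℕ) (ε : ℝ) (hε : 0 < ε) => exists_sqrt_sub_I_mul (hpos n) hε
  have hterm : ∀ ε : ℝ, 0 < ε → ∀ n, ∫ ω : ℝ,
      (Lam : ℂ) ^ 2 * poleTerm lam Lam ((ω : ℂ) ^ 2 + Complex.I * ε) n * ψ ω
      = (Lam : ℂ) ^ 2 * residueB n * ∫ t : ℝ, orderedKernel (c n ε) t * testHat ψ t := by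
    intro ε hε n
    rw [← integral_pole_mul_test (hc n ε hε).2.1, ← integral_const_mul]
    congr 1
    ext ω
    rw [poleTerm, (hc n ε hε).1]
    rw [show (ω : ℂ) ^ 2 + Complex.I * ε - (freq lam Lam n : ℂ) ^ 2
      = (ω : ℂ) ^ 2 - ((freq lam Lam n : ℂ) ^ 2 - Complex.I * ε) by ring]
    ring
  have hpair : fourierPairing (propagator lam Lam) ψ = ∑' n, (Lam : ℂ) ^ 2 * residueB n *
      ∫ t : ℝ, orderedKernel (freq lam Lam n) t * testHat ψ t := by
    rw [fourierPairing_eq, ← (hasSum_integral_propagator_mul hlam hLam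
      (integrable_testHat ψ).integrableOn).tsum_eq]
    congr 1
    ext n
    rw [integral_orderedKernel_ofReal (hpos n) ψ (hzero n)]
    push_cast
    ring
  rw [hpair]
  have hT := tendsto_tsum_of_dominated_convergence (𝓕 := 𝓝[>] (0 : ℝ))
    (f := fun ε n => (Lam : ℂ) ^ 2 * residueB n *
      ∫ t : ℝ, orderedKernel (c n ε) t * testHat ψ t)
    (g := fun n => (Lam : ℂ) ^ 2 * residueB n *
      ∫ t : ℝ, orderedKernel (freq lam Lam n) t * testHat ψ t)
    -- As `|c n ε| ≥ ω_n ≥ ω_0`, the kernels are bounded by `1/(2ω_0)` uniformly in `n` and `ε`.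
    (bound := fun n => ‖(Lam : ℂ) ^ 2‖ * |residueB n| *
      (1 / (2 * freq lam Lam 0) * ∫ t : ℝ, ‖testHat ψ t‖))
    ((summable_abs_residueB.mul_left _).mul_right _)
    (fun n => (tendsto_integral_orderedKernel (hpos n) (fun ε hε => (hc n ε hε).2) ψ).const_mul _)
    (by
      filter_upwards [self_mem_nhdsWithin] with ε hε n
      rw [norm_mul, norm_mul, Complex.norm_real, Real.norm_eq_abs]
      refine mul_le_mul_of_nonneg_left ?_ (by positivity)
      exact norm_integral_orderedKernel_le (hc n ε hε).2.1.le (hpos 0)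
        ((freq_zero_le hlam hLam n).trans (hc n ε hε).2.2.1) ψ)
  refine hT.congr' ?_
  filter_upwards [self_mem_nhdsWithin] with ε hε
  rw [← (hasSum_integral_poleTerm hε ψ).tsum_eq]
  exact tsum_congr fun n => (hterm ε hε n).symm

/-- The pole sum depends on `ω` only through `ω²`, so reflecting the test function reduces this to
the previous case and reverses time. -/
theorem tendsto_poleSum_ordered_neg (hlam : 0 < lam) (hLam : 0 < Lam) (ψ : 𝓢(ℝ, ℂ))
    (hψ : tsupport ψ ⊆ Set.Iio (freq lam Lam 0)) :
    Tendsto (fun ε : ℝ => ∫ ω : ℝ,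
        (Lam : ℂ) ^ 2 * poleSum lam Lam ((ω : ℂ) ^ 2 + Complex.I * ε) * ψ ω)
      (𝓝[>] 0) (𝓝 (fourierPairing (fun t => propagator lam Lam (-t)) ψ)) := by
  rw [fourierPairing_comp_neg]
  have hsupp : tsupport (reflectTest ψ) ⊆ Set.Ioi (-freq lam Lam 0) := by
    have : tsupport (reflectTest ψ) = (Homeomorph.neg ℝ) ⁻¹' tsupport ψ :=
      tsupport_comp_eq_preimage (⇑ψ) (Homeomorph.neg ℝ)
    rw [this]
    intro ω hω
    have := hψ hω
    simp only [Set.mem_Iio, Homeomorph.coe_neg, Set.mem_Ioi] at this ⊢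
    linarith
  refine (tendsto_poleSum_ordered hlam hLam (reflectTest ψ) hsupp).congr fun ε => ?_
  rw [← integral_neg_eq_self]
  simp [reflectTest_apply]

end TimeOrdered

/-! ### Analyticity below the first pole -/

section Analyticity

theorem norm_sq_sub_sq_ge {z : ℂ} {r x : ℝ} (hz : ‖z‖ ≤ r) : x ^ 2 - r ^ 2 ≤ ‖z ^ 2 - (x : ℂ) ^ 2‖ := by
  have h1 : ‖(x : ℂ) ^ 2‖ = x ^ 2 := by
    rw [norm_pow, Complex.norm_real, Real.norm_eq_abs, sq_abs]
  have h2 : ‖z ^ 2‖ ≤ r ^ 2 := by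
    rw [norm_pow]; exact pow_le_pow_left₀ (norm_nonneg _) hz 2
  have h3 := norm_sub_norm_le ((x : ℂ) ^ 2) (z ^ 2)
  rw [norm_sub_rev, h1] at h3
  linarith

/-- A series of simple poles is analytic on the real axis inside the first pole. -/
theorem analyticAt_tsum_pole {b a : ℕ → ℝ} (hb : Summable fun n => |b n|) (ha0 : 0 < a 0)
    (ha : ∀ n, a 0 ≤ a n) {x : ℝ} (hx : |x| < a 0) :
    AnalyticAt ℝ (fun ω : ℝ => ∑' n, (b n : ℂ) / ((ω : ℂ) ^ 2 - (a n : ℂ) ^ 2)) x := by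
  -- On the complex disc of radius `r` every denominator is at least `a 0 ^ 2 - r ^ 2` in modulus,
  -- so the series converges uniformly to a holomorphic function, which is then restricted to the
  -- real axis.
  obtain ⟨r, hxr, hra⟩ := exists_between hx
  have hr0 : 0 ≤ r := (abs_nonneg x).trans hxr.le
  have hδ : 0 < a 0 ^ 2 - r ^ 2 := by nlinarith
  have hden : ∀ n, ∀ z ∈ Metric.ball (0 : ℂ) r, a 0 ^ 2 - r ^ 2 ≤ ‖z ^ 2 - (a n : ℂ) ^ 2‖ := by
    intro n z hz
    refine le_trans ?_ (norm_sq_sub_sq_ge (mem_ball_zero_iff.1 hz).le)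
    nlinarith [ha n]
  have hdiff : DifferentiableOn ℂ (fun z : ℂ => ∑' n, (b n : ℂ) / (z ^ 2 - (a n : ℂ) ^ 2))
      (Metric.ball 0 r) := by
    refine Complex.differentiableOn_tsum_of_summable_norm
      (hb.mul_right (a 0 ^ 2 - r ^ 2)⁻¹) (fun n z hz => ?_) Metric.isOpen_ball fun n z hz => ?_
    · refine DifferentiableAt.differentiableWithinAt
        (DifferentiableAt.div (by fun_prop) (by fun_prop) ?_)
      exact norm_pos_iff.1 (hδ.trans_le (hden n z hz))
    · rw [norm_div, Complex.norm_real, Real.norm_eq_abs, div_eq_mul_inv]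
      exact mul_le_mul_of_nonneg_left (inv_anti₀ hδ (hden n z hz)) (abs_nonneg _)
  have hmem : (x : ℂ) ∈ Metric.ball (0 : ℂ) r := by
    rwa [mem_ball_zero_iff, Complex.norm_real]
  have han : AnalyticAt ℝ (fun z : ℂ => ∑' n, (b n : ℂ) / (z ^ 2 - (a n : ℂ) ^ 2)) (x : ℂ) :=
    (hdiff.analyticAt (Metric.isOpen_ball.mem_nhds hmem)).restrictScalars
  exact han.comp_of_eq (Complex.ofRealCLM.analyticAt x) rfl

theorem analyticAt_iteratedDeriv {f : ℝ → ℂ} {x : ℝ} (hf : AnalyticAt ℝ f x) (n : ℕ) :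
    AnalyticAt ℝ (iteratedDeriv n f) x := by
  rw [iteratedDeriv_eq_iterate]
  exact hf.iterated_deriv n

variable {lam Lam : ℝ}

theorem analyticAt_propagatorHat (hlam : 0 < lam) (hLam : 0 < Lam) {x : ℝ}
    (hx : x ∈ Set.Ioo (-freq lam Lam 0) (freq lam Lam 0)) :
    AnalyticAt ℝ (propagatorHat lam Lam) x :=
  analyticAt_const.mul (analyticAt_tsum_pole summable_abs_residueB (freq_pos hlam hLam 0)
    (freq_zero_le hlam hLam) (abs_lt.2 hx))

theorem hasDerivAt_iteratedDeriv_propagatorHat (hlam : 0 < lam) (hLam : 0 < Lam) {x : ℝ}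
    (hx : x ∈ Set.Ioo (-freq lam Lam 0) (freq lam Lam 0)) (n : ℕ) :
    HasDerivAt (iteratedDeriv n (propagatorHat lam Lam))
      (iteratedDeriv (n + 1) (propagatorHat lam Lam) x) x := by
  rw [iteratedDeriv_succ]
  exact (analyticAt_iteratedDeriv
    (analyticAt_propagatorHat hlam hLam hx) n).differentiableAt.hasDerivAt

end Analyticity

/-! ### Low-frequency transforms of the kernels `tⁿ G(t)` -/

section Pairing

variable {lam Lam : ℝ}

theorem hasCompactSupport_of_tsupport_subset_Ioo {f : ℝ → ℂ} {a b : ℝ}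
    (h : tsupport f ⊆ Set.Ioo a b) : HasCompactSupport f :=
  isCompact_Icc.of_isClosed_subset (isClosed_tsupport f) (h.trans Set.Ioo_subset_Icc_self)

theorem continuous_mul_of_tsupport_subset {f g : ℝ → ℂ} {U : Set ℝ}
    (hf : ∀ x ∈ U, ContinuousAt f x) (hg : Continuous g) (h : tsupport g ⊆ U) :
    Continuous fun x => f x * g x :=
  continuous_of_tsupport fun x hx =>
    (hf x (h (tsupport_mul_subset_right hx))).mul hg.continuousAt

/-- Integration by parts against a test function supported where `f` is differentiable. -/
theorem integral_mul_deriv_test {f f' : ℝ → ℂ} {a b : ℝ}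
    (hf : ∀ x ∈ Set.Ioo a b, HasDerivAt f (f' x) x)
    (hf' : ∀ x ∈ Set.Ioo a b, ContinuousAt f' x)
    (ψ : 𝓢(ℝ, ℂ)) (hψ : tsupport ψ ⊆ Set.Ioo a b) :
    ∫ x, f x * deriv ψ x = -∫ x, f' x * ψ x := by
  have hψ' : tsupport (deriv ψ) ⊆ Set.Ioo a b := tsupport_deriv_subset.trans hψ
  have hcψ' : Continuous (deriv ψ) := (SchwartzMap.derivCLM ℝ ℂ ψ).continuous
  have c1 := continuous_mul_of_tsupport_subset (fun x hx => (hf x hx).continuousAt) hcψ' hψ'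
  have c2 := continuous_mul_of_tsupport_subset hf' ψ.continuous hψ
  have s1 := hasCompactSupport_of_tsupport_subset_Ioo hψ
  have i1 : Integrable fun x => f x * deriv ψ x :=
    c1.integrable_of_hasCompactSupport
      (hasCompactSupport_of_tsupport_subset_Ioo hψ').mul_left
  have i2 : Integrable fun x => f' x * ψ x :=
    c2.integrable_of_hasCompactSupport s1.mul_left
  have c3 := continuous_mul_of_tsupport_subset (fun x hx => (hf x hx).continuousAt)
    ψ.continuous hψ
  have i3 : Integrable fun x => f x * ψ x :=
    c3.integrable_of_hasCompactSupport s1.mul_left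
  have hd : ∀ x, HasDerivAt (fun x => f x * ψ x) (f' x * ψ x + f x * deriv ψ x) x := by
    intro x
    by_cases hx : x ∈ tsupport ψ
    · exact (hf x (hψ hx)).mul (ψ.hasDerivAt x)
    · have h0 := notMem_tsupport_iff_eventuallyEq.1 hx
      have h1 : ψ x = 0 := h0.eq_of_nhds
      have h2 : deriv ψ x = 0 := by rw [h0.deriv_eq]; simp
      rw [h1, h2, mul_zero, mul_zero, add_zero]
      refine (hasDerivAt_const x (0 : ℂ)).congr_of_eventuallyEq ?_
      filter_upwards [h0] with y hy
      simp [hy]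
  have := integral_eq_zero_of_hasDerivAt_of_integrable hd (i2.add i1) i3
  rw [integral_add i2 i1] at this
  linear_combination this

theorem testHat_deriv (ψ : 𝓢(ℝ, ℂ)) (t : ℝ) :
    testHat (SchwartzMap.derivCLM ℝ ℂ ψ) t = -(Complex.I * t) * testHat ψ t := by
  have hexp : ∀ ω : ℝ, HasDerivAt (fun ω : ℝ => Complex.exp (Complex.I * ω * t))
      (Complex.I * t * Complex.exp (Complex.I * ω * t)) ω := fun ω => by
    have h := (((Complex.ofRealCLM.hasDerivAt (x := ω)).const_mul Complex.I).mul_const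
      (t : ℂ)).cexp
    refine h.congr_deriv ?_
    simp
    ring
  have hb : ∀ φ : 𝓢(ℝ, ℂ), Integrable fun ω : ℝ => Complex.exp (Complex.I * ω * t) * φ ω :=
    fun φ => (φ.integrable (μ := volume)).bdd_mul (c := 1) (by fun_prop : Continuous fun ω : ℝ =>
      Complex.exp (Complex.I * ω * t)).aestronglyMeasurable
      (Eventually.of_forall fun ω => (norm_exp_I_mul_mul _ _).le)
  have h := integral_mul_deriv_eq_deriv_mul_of_integrable
    (u := fun ω : ℝ => Complex.exp (Complex.I * ω * t)) (v := ψ)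
    (u' := fun ω : ℝ => Complex.I * t * Complex.exp (Complex.I * ω * t)) (v' := deriv ψ)
    (fun ω _ => hexp ω) (fun ω _ => ψ.hasDerivAt ω) (hb (SchwartzMap.derivCLM ℝ ℂ ψ))
    (by
      refine ((hb ψ).const_mul (Complex.I * t)).congr (Eventually.of_forall fun ω => ?_)
      simp only [Pi.mul_apply]
      ring) (hb ψ)
  simp only [testHat, SchwartzMap.derivCLM_apply]
  rw [h, neg_mul, ← integral_const_mul]
  congr 2
  ext ω
  ring

/-- The integrands agree for every `t`, as the transform of `ψ'` is `-it` times that of `ψ`;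
integrability of `t f(t)` against anything is not needed. -/
theorem fourierPairing_deriv (f : ℝ → ℝ) (ψ : 𝓢(ℝ, ℂ)) :
    fourierPairing (fun t => t * f t) ψ
      = Complex.I * fourierPairing f (SchwartzMap.derivCLM ℝ ℂ ψ) := by
  rw [fourierPairing_eq, fourierPairing_eq, ← integral_const_mul]
  congr 1
  ext t
  rw [testHat_deriv]
  push_cast
  linear_combination (f t * t * testHat ψ t) * Complex.I_sq

theorem exists_gap {ψ : 𝓢(ℝ, ℂ)} {a : ℝ} (hψ : tsupport ψ ⊆ Set.Ioo (-a) a) :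
    ∃ δ > 0, ∀ ω ∈ tsupport ψ, δ ≤ a ^ 2 - ω ^ 2 := by
  have hc := hasCompactSupport_of_tsupport_subset_Ioo hψ
  obtain ⟨δ, hδ, h⟩ := hc.isCompact.exists_forall_le' (f := fun ω : ℝ => a ^ 2 - ω ^ 2) (a := 0)
    (by fun_prop) fun ω hω => by
      have := abs_lt.2 (hψ hω)
      have h2 := sq_lt_sq' (by linarith [abs_nonneg ω]) this
      rw [sq_abs] at h2
      linarith
  exact ⟨δ, hδ, h⟩

/-- The real part alone gives the bound, so it is uniform in `ε` and includes `ε = 0`. -/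
theorem le_norm_pole {ω ε a x δ : ℝ} (ha : 0 < a) (hax : a ≤ x) (hδ : δ ≤ a ^ 2 - ω ^ 2) :
    δ ≤ ‖(ω : ℂ) ^ 2 + Complex.I * ε - (x : ℂ) ^ 2‖ := by
  have h := Complex.abs_re_le_norm ((ω : ℂ) ^ 2 + Complex.I * ε - (x : ℂ) ^ 2)
  refine le_trans ?_ h
  rw [← Complex.ofReal_pow, ← Complex.ofReal_pow]
  simp only [Complex.sub_re, Complex.add_re, Complex.ofReal_re, Complex.mul_re, Complex.I_re,
    Complex.I_im, Complex.ofReal_im]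
  have := neg_abs_le (ω ^ 2 + (0 * ε - 1 * 0) - x ^ 2)
  nlinarith

theorem continuous_poleSum {ε : ℝ} (hε : 0 < ε) :
    Continuous fun ω : ℝ => poleSum lam Lam ((ω : ℂ) ^ 2 + Complex.I * ε) := by
  refine continuous_tsum (fun n => ?_) (summable_abs_residueB.mul_right ε⁻¹)
    fun n ω => norm_poleTerm_le ω hε n
  refine Continuous.div (by fun_prop) (by fun_prop) fun ω h => ?_
  have := im_sq_add_I_mul ω ε
  rw [sub_eq_zero.1 h, ← Complex.ofReal_pow, Complex.ofReal_im] at this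
  linarith

/-- A test supported in `(-ω_0, ω_0)` stays at positive distance from all poles, so `ε → 0` may be
taken under sum and integral; uniqueness of limits compares the result with the time-ordered one. -/
theorem fourierPairing_propagator_low (hlam : 0 < lam) (hLam : 0 < Lam) (ψ : 𝓢(ℝ, ℂ))
    (hψ : tsupport ψ ⊆ Set.Ioo (-freq lam Lam 0) (freq lam Lam 0)) :
    fourierPairing (propagator lam Lam) ψ = ∫ ω : ℝ, propagatorHat lam Lam ω * ψ ω := by
  refine tendsto_nhds_unique (tendsto_poleSum_ordered hlam hLam ψ
    (hψ.trans Set.Ioo_subset_Ioi_self)) ?_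
  obtain ⟨δ, hδ, hgap⟩ := exists_gap hψ
  have hterm : ∀ ω ∈ tsupport ψ, ∀ ε : ℝ, ∀ n,
      ‖poleTerm lam Lam ((ω : ℂ) ^ 2 + Complex.I * ε) n‖ ≤ |residueB n| * δ⁻¹ := by
    intro ω hω ε n
    rw [poleTerm, norm_div, Complex.norm_real, Real.norm_eq_abs, div_eq_mul_inv]
    exact mul_le_mul_of_nonneg_left (inv_anti₀ hδ (le_norm_pole (freq_pos hlam hLam 0)
      (freq_zero_le hlam hLam n) (hgap ω hω))) (abs_nonneg _)
  have hs := summable_abs_residueB.mul_right δ⁻¹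
  have hzero : ∀ ω, ω ∉ tsupport ψ → ψ ω = 0 := fun ω hω => image_eq_zero_of_notMem_tsupport hω
  refine tendsto_integral_filter_of_dominated_convergence
    (fun ω => ‖(Lam : ℂ) ^ 2‖ * (∑' n, |residueB n| * δ⁻¹) * ‖ψ ω‖) ?_ ?_
    ((ψ.integrable (μ := volume)).norm.const_mul _) ?_
  · filter_upwards [self_mem_nhdsWithin] with ε hε
    exact ((continuous_poleSum hε).const_mul _ |>.mul ψ.continuous).aestronglyMeasurable
  · refine Eventually.of_forall fun ε => Eventually.of_forall fun ω => ?_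
    by_cases hω : ω ∈ tsupport ψ
    · rw [norm_mul, norm_mul]
      gcongr
      exact tsum_of_norm_bounded hs.hasSum (hterm ω hω ε)
    · rw [hzero ω hω]; simp
  · refine Eventually.of_forall fun ω => ?_
    by_cases hω : ω ∈ tsupport ψ
    · refine Tendsto.mul_const _ (Tendsto.const_mul _ ?_)
      refine tendsto_tsum_of_dominated_convergence hs (fun n => ?_)
        (Eventually.of_forall fun ε => hterm ω hω ε)
      have hne : (ω : ℂ) ^ 2 + Complex.I * (0 : ℝ) - (freq lam Lam n : ℂ) ^ 2 ≠ 0 :=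
        norm_pos_iff.1 (hδ.trans_le (le_norm_pole (freq_pos hlam hLam 0)
          (freq_zero_le hlam hLam n) (hgap ω hω)))
      have hc : ContinuousAt (fun ε : ℝ =>
          poleTerm lam Lam ((ω : ℂ) ^ 2 + Complex.I * ε) n) 0 := by
        unfold poleTerm
        exact ContinuousAt.div (by fun_prop) (by fun_prop) hne
      have := hc.tendsto.mono_left (nhdsWithin_le_nhds (s := Set.Ioi 0))
      simpa using this
    · rw [hzero ω hω]; simp

/-- Each factor `t` contributes `i` and a derivative on `ψ`; moving that derivative onto the
transform changes the sign, whence `-i` per factor. -/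
theorem fourierPairing_pow_mul_propagator (hlam : 0 < lam) (hLam : 0 < Lam) (n : ℕ)
    (ψ : 𝓢(ℝ, ℂ)) (hψ : tsupport ψ ⊆ Set.Ioo (-freq lam Lam 0) (freq lam Lam 0)) :
    fourierPairing (fun t => t ^ n * propagator lam Lam t) ψ =
      ∫ ω : ℝ, (-Complex.I) ^ n * iteratedDeriv n (propagatorHat lam Lam) ω * ψ ω := by
  induction n generalizing ψ with
  | zero => simpa using fourierPairing_propagator_low hlam hLam ψ hψ
  | succ n ih =>
    have e : (fun t => t ^ (n + 1) * propagator lam Lam t)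
        = fun t => t * (t ^ n * propagator lam Lam t) := by
      ext t; ring
    rw [e, fourierPairing_deriv, ih _ ((SchwartzMap.tsupport_derivCLM_subset ℝ ψ).trans hψ)]
    simp only [mul_assoc, integral_const_mul, SchwartzMap.derivCLM_apply]
    rw [integral_mul_deriv_test
      (fun x hx => hasDerivAt_iteratedDeriv_propagatorHat hlam hLam hx n)
      (fun x hx => (analyticAt_iteratedDeriv
        (analyticAt_propagatorHat hlam hLam hx) (n + 1)).continuousAt) ψ hψ]
    ring

end Pairing

/-! ### Dependence on the coupling -/

section Scaling

variable {lam Lam : ℝ}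

theorem iteratedDeriv_comp_mul (f : ℝ → ℂ) (c : ℝ) (n : ℕ) :
    iteratedDeriv n (fun x => f (c * x)) = fun x => (c : ℂ) ^ n * iteratedDeriv n f (c * x) := by
  induction n with
  | zero => simp
  | succ n ih =>
    ext x
    rw [iteratedDeriv_succ, ih, deriv_const_mul_field, deriv_comp_mul_left, iteratedDeriv_succ,
      Complex.real_smul]
    ring

theorem rootScale_two : rootScale 2 = 1 := by simp [rootScale]

theorem freq_eq_mul (n : ℕ) : freq lam Lam n = rootScale lam * freq 2 Lam n := by
  rw [freq_eq, freq_eq, rootScale_two]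
  ring

/-- All poles scale by `s = rootScale lam` while the `B_n` do not depend on `λ`, so `s²` factors out
of each denominator. Each derivative at 0 then adds one more `s⁻¹`. -/
theorem propagatorHat_scaling (hlam : 0 < lam) :
    propagatorHat lam Lam = fun ω => ((rootScale lam)⁻¹ : ℂ) ^ 2 *
      propagatorHat 2 Lam ((rootScale lam)⁻¹ * ω) := by
  have hs : (rootScale lam : ℂ) ≠ 0 := by exact_mod_cast (rootScale_pos hlam).ne'
  ext ω
  rw [propagatorHat, propagatorHat, mul_left_comm, poleSum, poleSum]
  congr 1
  rw [← tsum_mul_left]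
  congr 1
  ext n
  rw [poleTerm, poleTerm, freq_eq_mul (lam := lam)]
  push_cast
  rw [show (ω : ℂ) ^ 2 - (rootScale lam * freq 2 Lam n) ^ 2
    = (rootScale lam : ℂ) ^ 2 * (((rootScale lam : ℂ)⁻¹ * ω) ^ 2 - (freq 2 Lam n : ℂ) ^ 2) by
      field_simp, inv_pow, div_mul_eq_div_div, div_right_comm, div_eq_inv_mul]

theorem iteratedDeriv_propagatorHat_zero (hlam : 0 < lam) (n : ℕ) :
    iteratedDeriv n (propagatorHat lam Lam) 0 =
      (((2 / lam) ^ (((n : ℝ) + 2) / 4) : ℝ) : ℂ) * iteratedDeriv n (propagatorHat 2 Lam) 0 := by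
  have hpow : (2 / lam) ^ (((n : ℝ) + 2) / 4) = (rootScale lam)⁻¹ ^ (n + 2) := by
    rw [← rootScale_inv hlam, ← Real.rpow_natCast, ← Real.rpow_mul (by positivity)]
    congr 1
    push_cast
    ring
  have h := iteratedDeriv_comp_mul (fun x => propagatorHat 2 Lam x) (rootScale lam)⁻¹ n
  rw [propagatorHat_scaling hlam, iteratedDeriv_const_mul_field, h, hpow]
  push_cast
  rw [mul_zero]
  ring

end Scaling

/-! ### The first correction at low frequency -/

section Correction

variable {lam Lam : ℝ}

theorem summable_residueB_div_pow (hlam : 0 < lam) (hLam : 0 < Lam) (k : ℕ) :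
    Summable fun n => |residueB n / freq lam Lam n ^ k| := by
  refine Summable.of_nonneg_of_le (fun _ => abs_nonneg _) (fun n => ?_)
    (summable_abs_residueB.mul_right (freq lam Lam 0 ^ k)⁻¹)
  have h0 := freq_pos hlam hLam 0
  have hn := freq_zero_le hlam hLam n
  rw [abs_div, div_eq_mul_inv, abs_of_pos (pow_pos (freq_pos hlam hLam n) k)]
  gcongr

theorem exists_analyticAt_deriv_pow_mul {R : ℝ → ℂ} (hR : AnalyticAt ℝ R 0) (k : ℕ) :
    ∃ S : ℝ → ℂ, AnalyticAt ℝ S 0 ∧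
      deriv (fun x : ℝ => (x : ℂ) ^ (k + 1) * R x) =ᶠ[𝓝 0] fun x : ℝ => (x : ℂ) ^ k * S x := by
  have hid : AnalyticAt ℝ (fun x : ℝ => (x : ℂ)) 0 := Complex.ofRealCLM.analyticAt 0
  refine ⟨fun x => (k + 1 : ℂ) * R x + x * deriv R x,
    (analyticAt_const.mul hR).add (hid.mul hR.deriv), ?_⟩
  filter_upwards [hR.eventually_analyticAt] with x hx
  have h1 := ((Complex.ofRealCLM.hasDerivAt (x := x)).pow (k + 1)).mul
    hx.differentiableAt.hasDerivAt
  refine h1.deriv.trans ?_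
  simp only [Complex.ofRealCLM_apply, Pi.pow_apply, Nat.add_sub_cancel, Complex.ofReal_one]
  push_cast
  ring

/-- Each derivative costs one power of `x` and keeps the other factor analytic. With `k = 2` and `j
= 4` it shows that the `ω⁶` remainder contributes only `O(ω²)`. -/
theorem exists_analyticAt_iteratedDeriv_pow_mul {R : ℝ → ℂ} (hR : AnalyticAt ℝ R 0) (k j : ℕ) :
    ∃ S : ℝ → ℂ, AnalyticAt ℝ S 0 ∧
      iteratedDeriv j (fun x : ℝ => (x : ℂ) ^ (k + j) * R x) =ᶠ[𝓝 0]
        fun x : ℝ => (x : ℂ) ^ k * S x := by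
  induction j generalizing k with
  | zero => exact ⟨R, hR, by simp⟩
  | succ j ih =>
    obtain ⟨S, hS, hSe⟩ := ih (k + 1)
    obtain ⟨T, hT, hTe⟩ := exists_analyticAt_deriv_pow_mul hS k
    refine ⟨T, hT, ?_⟩
    rw [iteratedDeriv_succ, show k + (j + 1) = k + 1 + j by ring]
    exact hSe.deriv.trans hTe

theorem iteratedDeriv_four_even_quartic (c₀ c₂ c₄ : ℂ) :
    iteratedDeriv 4 (fun x : ℝ => c₀ + c₂ * (x : ℂ) ^ 2 + c₄ * (x : ℂ) ^ 4)
      = fun _ => 24 * c₄ := by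
  have hp : ∀ (k : ℕ) (x : ℝ), HasDerivAt (fun x : ℝ => (x : ℂ) ^ (k + 1))
      ((k + 1) * (x : ℂ) ^ k) x := fun k x => by
    refine ((Complex.ofRealCLM.hasDerivAt (x := x)).pow (k + 1)).congr_deriv ?_
    simp
  have d1 : deriv (fun x : ℝ => c₀ + c₂ * (x : ℂ) ^ 2 + c₄ * (x : ℂ) ^ 4)
      = fun x : ℝ => 2 * c₂ * (x : ℂ) ^ 1 + 4 * c₄ * (x : ℂ) ^ 3 := funext fun x => by
    refine HasDerivAt.deriv (((((hp 1 x).const_mul c₂).const_add c₀).add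
      ((hp 3 x).const_mul c₄)).congr_deriv ?_)
    push_cast
    ring
  have d2 : deriv (fun x : ℝ => 2 * c₂ * (x : ℂ) ^ 1 + 4 * c₄ * (x : ℂ) ^ 3)
      = fun x : ℝ => 2 * c₂ + 12 * c₄ * (x : ℂ) ^ 2 := funext fun x => by
    refine HasDerivAt.deriv ((((hp 0 x).const_mul (2 * c₂)).add
      ((hp 2 x).const_mul (4 * c₄))).congr_deriv ?_)
    push_cast
    ring
  have d3 : deriv (fun x : ℝ => 2 * c₂ + 12 * c₄ * (x : ℂ) ^ 2)
      = fun x : ℝ => 24 * c₄ * (x : ℂ) ^ 1 := funext fun x => by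
    refine HasDerivAt.deriv ((((hp 1 x).const_mul (12 * c₄)).const_add (2 * c₂)).congr_deriv ?_)
    push_cast
    ring
  have d4 : deriv (fun x : ℝ => 24 * c₄ * (x : ℂ) ^ 1) = fun _ => 24 * c₄ := funext fun x => by
    refine HasDerivAt.deriv (((hp 0 x).const_mul (24 * c₄)).congr_deriv ?_)
    push_cast
    ring
  simp only [iteratedDeriv_eq_iterate, Function.iterate_succ, Function.comp_apply,
    Function.iterate_zero, id, d1, d2, d3, d4]

/-- The part of `∑_n B_n / (ω² - ω_n²)` of order `ω⁶` and higher, divided by `ω⁶`. -/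
def poleRemainder (lam Lam ω : ℝ) : ℂ :=
  ∑' n, ((residueB n / freq lam Lam n ^ 6 : ℝ) : ℂ) / ((ω : ℂ) ^ 2 - (freq lam Lam n : ℂ) ^ 2)

/-- Termwise, a geometric expansion with exact remainder: `1/(ω² - a²) = -1/a² - ω²/a⁴ - ω⁴/a⁶ +
ω⁶/(a⁶(ω² - a²))`. -/
theorem poleSum_expansion (hlam : 0 < lam) (hLam : 0 < Lam) {ω : ℝ}
    (hω : ω ∈ Set.Ioo (-freq lam Lam 0) (freq lam Lam 0)) :
    poleSum lam Lam ((ω : ℂ) ^ 2) =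
      -((∑' n, residueB n / freq lam Lam n ^ 2 : ℝ) : ℂ)
        + -((∑' n, residueB n / freq lam Lam n ^ 4 : ℝ) : ℂ) * (ω : ℂ) ^ 2
        + -((∑' n, residueB n / freq lam Lam n ^ 6 : ℝ) : ℂ) * (ω : ℂ) ^ 4
        + (ω : ℂ) ^ 6 * poleRemainder lam Lam ω := by
  have hsum : ∀ k : ℕ, HasSum (fun n => ((residueB n / freq lam Lam n ^ k : ℝ) : ℂ))
      ((∑' n, residueB n / freq lam Lam n ^ k : ℝ) : ℂ) := fun k =>
    Complex.hasSum_ofReal.2 (summable_residueB_div_pow hlam hLam k).of_abs.hasSum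
  have hω2 : 0 < freq lam Lam 0 ^ 2 - ω ^ 2 := by nlinarith [hω.1, hω.2]
  have hden : ∀ n, freq lam Lam 0 ^ 2 - ω ^ 2
      ≤ ‖(ω : ℂ) ^ 2 - (freq lam Lam n : ℂ) ^ 2‖ := fun n => by
    have := le_norm_pole (ω := ω) (ε := 0) (freq_pos hlam hLam 0) (freq_zero_le hlam hLam n) le_rfl
    simpa using this
  have hR : Summable fun n => ((residueB n / freq lam Lam n ^ 6 : ℝ) : ℂ) /
      ((ω : ℂ) ^ 2 - (freq lam Lam n : ℂ) ^ 2) := by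
    refine Summable.of_norm_bounded ((summable_residueB_div_pow hlam hLam 6).mul_right
      (freq lam Lam 0 ^ 2 - ω ^ 2)⁻¹) fun n => ?_
    rw [norm_div, Complex.norm_real, Real.norm_eq_abs, div_eq_mul_inv]
    exact mul_le_mul_of_nonneg_left (inv_anti₀ hω2 (hden n)) (abs_nonneg _)
  have h := (((hsum 2).neg.add ((hsum 4).neg.mul_right ((ω : ℂ) ^ 2))).add
    ((hsum 6).neg.mul_right ((ω : ℂ) ^ 4))).add (hR.hasSum.mul_left ((ω : ℂ) ^ 6))
  refine Eq.trans ?_ h.tsum_eq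
  rw [poleSum]
  congr 1
  ext n
  have hne : (ω : ℂ) ^ 2 - (freq lam Lam n : ℂ) ^ 2 ≠ 0 :=
    norm_pos_iff.1 (hω2.trans_le (hden n))
  have hf : (freq lam Lam n : ℂ) ≠ 0 := by exact_mod_cast (freq_pos hlam hLam n).ne'
  rw [poleTerm]
  push_cast
  field_simp
  ring

/-- The fourth derivative removes the terms of order 0 and 2 and turns the quartic term into a
constant; the factor `24 · (1/20) = 6/5` is the one in `correctionConst`. -/
theorem firstCorrection_isBigO (hlam : 0 < lam) (hLam : 0 < Lam) :
    (fun ω : ℝ => firstCorrection lam Lam ω - (correctionConst lam Lam : ℂ))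
      =O[𝓝 0] fun ω : ℝ => ω ^ 2 := by
  have hf0 := freq_pos hlam hLam 0
  have h0 : (0 : ℝ) ∈ Set.Ioo (-freq lam Lam 0) (freq lam Lam 0) := ⟨by linarith, hf0⟩
  set L2 : ℂ := (Lam : ℂ) ^ 2 with hL2
  set C : ℕ → ℂ := fun k => -((∑' n, residueB n / freq lam Lam n ^ k : ℝ) : ℂ) with hC
  have hrem : AnalyticAt ℝ (fun ω => L2 * poleRemainder lam Lam ω) 0 :=
    analyticAt_const.mul (analyticAt_tsum_pole (summable_residueB_div_pow hlam hLam 6) hf0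
      (freq_zero_le hlam hLam) (by simpa using hf0))
  have hexp : propagatorHat lam Lam =ᶠ[𝓝 0] fun ω : ℝ =>
      (L2 * C 2 + L2 * C 4 * (ω : ℂ) ^ 2 + L2 * C 6 * (ω : ℂ) ^ 4)
        + (ω : ℂ) ^ (2 + 4) * (L2 * poleRemainder lam Lam ω) := by
    filter_upwards [isOpen_Ioo.mem_nhds h0] with ω hω
    rw [propagatorHat, poleSum_expansion hlam hLam hω]
    simp only [hC, hL2]
    ring
  obtain ⟨S, hS, hSe⟩ := exists_analyticAt_iteratedDeriv_pow_mul hrem 2 4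
  have hid : ∀ x : ℝ, AnalyticAt ℝ (fun x : ℝ => (x : ℂ)) x := fun x =>
    Complex.ofRealCLM.analyticAt x
  have hder : iteratedDeriv 4 (propagatorHat lam Lam) =ᶠ[𝓝 0] fun ω : ℝ =>
      24 * (L2 * C 6) + (ω : ℂ) ^ 2 * S ω := by
    filter_upwards [hexp.eventuallyEq_nhds, hSe, hrem.eventually_analyticAt] with ω h1 h2 h3
    rw [h1.iteratedDeriv_eq 4, iteratedDeriv_fun_add, h2, iteratedDeriv_four_even_quartic]
    · exact ((analyticAt_const.add (analyticAt_const.mul ((hid ω).pow 2))).add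
        (analyticAt_const.mul ((hid ω).pow 4))).contDiffAt
    · exact (((hid ω).pow (2 + 4)).mul h3).contDiffAt
  have heq : (fun ω : ℝ => firstCorrection lam Lam ω - (correctionConst lam Lam : ℂ))
      =ᶠ[𝓝 0] fun ω : ℝ => (ω : ℂ) ^ 2 * (((lam * Lam ^ 4 / 20 : ℝ) : ℂ) * S ω) := by
    filter_upwards [hder] with ω hω
    rw [firstCorrection, hω, correctionConst]
    simp only [hC, hL2]
    push_cast
    ring
  refine IsBigO.trans heq.isBigO ?_
  have hb : (fun ω : ℝ => ((lam * Lam ^ 4 / 20 : ℝ) : ℂ) * S ω) =O[𝓝 0] fun _ => (1 : ℝ) :=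
    (continuousAt_const.mul hS.continuousAt).tendsto.isBigO_one ℝ
  have hsq : (fun ω : ℝ => (ω : ℂ) ^ 2) =O[𝓝 0] fun ω : ℝ => ω ^ 2 :=
    IsBigO.of_norm_le fun ω => by simp
  simpa using hsq.mul hb

theorem tendsto_rootScale : Tendsto rootScale atTop atTop :=
  (tendsto_rpow_atTop (by norm_num)).comp (tendsto_id.atTop_div_const (by norm_num))

/-- With `s = rootScale l`, the sum scales as `s⁻⁶` and `l = 2 s⁴`, so the constant is a fixed
multiple of `s⁻²`. -/
theorem tendsto_correctionConst :
    Tendsto (fun l : ℝ => correctionConst l Lam) atTop (𝓝 0) := by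
  have h : Tendsto (fun l : ℝ => -(6 / 5) * Lam ^ 6 * 2 *
      (∑' n, residueB n / freq 2 Lam n ^ 6) * (rootScale l ^ 2)⁻¹) atTop (𝓝 0) := by
    have := ((tendsto_inv_atTop_zero.comp ((tendsto_pow_atTop (two_ne_zero)).comp
      tendsto_rootScale)).const_mul (-(6 / 5) * Lam ^ 6 * 2 *
        (∑' n, residueB n / freq 2 Lam n ^ 6)))
    simpa using this
  refine h.congr' ?_
  filter_upwards [eventually_gt_atTop 0] with l hl
  have hs := rootScale_pos hl
  have h4 : l = 2 * rootScale l ^ 4 := by rw [rootScale_pow_four hl]; ring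
  have hterm : ∀ n, residueB n / freq l Lam n ^ 6
      = (rootScale l ^ 6)⁻¹ * (residueB n / freq 2 Lam n ^ 6) := fun n => by
    rw [freq_eq_mul, mul_pow, div_mul_eq_div_div, div_right_comm, div_eq_inv_mul _ (_ ^ 6)]
  rw [correctionConst]
  simp only [hterm, tsum_mul_left]
  generalize ∑' n, residueB n / freq 2 Lam n ^ 6 = T
  field_simp
  linear_combination (Lam ^ 6 * T) * h4

end Correction

end QuarticPropagator

end

theorem theorem3 (lam Lam : ℝ) (hlam : 0 < lam) (hLam : 0 < Lam) :
    -- Green function equation in units of time with `Λ = 1`, and for general `Λ`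
    (IsGreenFunction (fun x => lam * x ^ 3) 1 (propagator lam 1) ∧
      (∀ t, propagator lam Lam t = Lam * propagator lam 1 (Lam * t)) ∧
      IsGreenFunction (fun x => lam * x ^ 3) (Lam ^ 2) (propagator lam Lam)) ∧
    -- it is the only forward-propagating solution
    ((∀ t < 0, propagator lam Lam t = 0) ∧
      ∀ H : ℝ → ℝ, IsGreenFunction (fun x => lam * x ^ 3) (Lam ^ 2) H →
        (∀ᵐ t, t < 0 → H t = 0) → H =ᵐ[volume] propagator lam Lam) ∧
    -- `G(-t)` is a solution, and the only backward-propagating one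
    (IsGreenFunction (fun x => lam * x ^ 3) (Lam ^ 2) (fun t => propagator lam Lam (-t)) ∧
      (∀ t > 0, propagator lam Lam (-t) = 0) ∧
      ∀ H : ℝ → ℝ, IsGreenFunction (fun x => lam * x ^ 3) (Lam ^ 2) H →
        (∀ᵐ t, 0 < t → H t = 0) → H =ᵐ[volume] fun t => propagator lam Lam (-t)) ∧
    -- the Fourier series of `sn(u, i)`
    (∀ u : ℝ, HasSum
      (fun n : ℕ => snCoeff n * Real.sin ((2 * n + 1) * (Real.pi * u / (2 * KI)))) (snI u)) ∧
    -- the transform at complex frequency `ω + iε`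
    (∀ ω ε : ℝ, 0 < ε →
      Integrable (fun t : ℝ => (propagator lam Lam t : ℂ) *
        Complex.exp (Complex.I * (ω + Complex.I * ε) * t)) ∧
      HasSum (fun n => (Lam : ℂ) ^ 2 * poleTerm lam Lam ((ω + Complex.I * ε) ^ 2) n)
        (∫ t : ℝ, (propagator lam Lam t : ℂ) *
          Complex.exp (Complex.I * (ω + Complex.I * ε) * t))) ∧
    -- the Fourier transform of `G` as a tempered distribution, `ω` replaced by `ω + i0`
    (∀ ψ : 𝓢(ℝ, ℂ), Tendsto
      (fun ε : ℝ => ∫ ω : ℝ,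
        (Lam : ℂ) ^ 2 * poleSum lam Lam ((ω + Complex.I * ε) ^ 2) * ψ ω)
      (𝓝[>] 0) (𝓝 (fourierPairing (propagator lam Lam) ψ))) ∧
    -- the form `∑ B_n / (ω² - ω_n² + iε)`: it is the transform of `G(t)` for `ω > -ω_0`
    -- and the transform of `G(-t)` for `ω < ω_0`
    ((∀ ω ε : ℝ, 0 < ε → Summable (poleTerm lam Lam ((ω : ℂ) ^ 2 + Complex.I * ε))) ∧
      (∀ ψ : 𝓢(ℝ, ℂ), tsupport ψ ⊆ Set.Ioi (-freq lam Lam 0) → Tendsto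
        (fun ε : ℝ => ∫ ω : ℝ,
          (Lam : ℂ) ^ 2 * poleSum lam Lam ((ω : ℂ) ^ 2 + Complex.I * ε) * ψ ω)
        (𝓝[>] 0) (𝓝 (fourierPairing (propagator lam Lam) ψ))) ∧
      (∀ ψ : 𝓢(ℝ, ℂ), tsupport ψ ⊆ Set.Iio (freq lam Lam 0) → Tendsto
        (fun ε : ℝ => ∫ ω : ℝ,
          (Lam : ℂ) ^ 2 * poleSum lam Lam ((ω : ℂ) ^ 2 + Complex.I * ε) * ψ ω)
        (𝓝[>] 0) (𝓝 (fourierPairing (fun t => propagator lam Lam (-t)) ψ)))) ∧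
    -- near `ω = 0` the kernels `tⁿ G(t)` of the correction series have the transforms
    -- `(-i)ⁿ dⁿĜ/dωⁿ`, which tend to constants of order `λ^{-(n+2)/4}`
    (ContDiffOn ℝ ((⊤ : ℕ∞) : WithTop ℕ∞) (propagatorHat lam Lam)
        (Set.Ioo (-freq lam Lam 0) (freq lam Lam 0)) ∧
      ∀ n : ℕ,
        (∀ ψ : 𝓢(ℝ, ℂ), tsupport ψ ⊆ Set.Ioo (-freq lam Lam 0) (freq lam Lam 0) →
          fourierPairing (fun t => t ^ n * propagator lam Lam t) ψ =
            ∫ ω : ℝ, (-Complex.I) ^ n * iteratedDeriv n (propagatorHat lam Lam) ω * ψ ω) ∧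
        Tendsto (iteratedDeriv n (propagatorHat lam Lam)) (𝓝 0)
          (𝓝 (iteratedDeriv n (propagatorHat lam Lam) 0)) ∧
        iteratedDeriv n (propagatorHat lam Lam) 0 =
          (((2 / lam) ^ (((n : ℝ) + 2) / 4) : ℝ) : ℂ) *
            iteratedDeriv n (propagatorHat 2 Lam) 0) ∧
    -- the first correction: a constant up to `O(ω²)`, the constant vanishing as `λ → ∞`
    ((Summable fun n => residueB n / freq lam Lam n ^ 6) ∧
      ((fun ω : ℝ => firstCorrection lam Lam ω - (correctionConst lam Lam : ℂ))
        =O[𝓝 0] fun ω : ℝ => ω ^ 2) ∧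
      Tendsto (fun l : ℝ => correctionConst l Lam) atTop (𝓝 0)) := by
  have h0 : (0 : ℝ) ∈ Set.Ioo (-freq lam Lam 0) (freq lam Lam 0) :=
    ⟨neg_neg_of_pos (freq_pos hlam hLam 0), freq_pos hlam hLam 0⟩
  refine ⟨⟨by simpa using isGreenFunction_propagator (Lam := 1) hlam,
      fun t => propagator_scaling t hLam, isGreenFunction_propagator hlam⟩,
    ⟨fun t => propagator_of_neg, fun H => ae_eq_propagator hlam⟩,
    ⟨(isGreenFunction_propagator hlam).comp_neg,
      fun t ht => propagator_of_neg (neg_neg_of_pos ht), fun H => ae_eq_propagator_neg hlam⟩,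
    hasSum_snI,
    fun ω ε hε => ⟨integrable_propagator_mul hlam hLam (integrableOn_exp_frequency ω hε),
      hasSum_transform hlam hLam ω hε⟩,
    tendsto_poleSum_retarded hlam hLam,
    ⟨fun ω ε hε => summable_poleTerm ω hε, tendsto_poleSum_ordered hlam hLam,
      tendsto_poleSum_ordered_neg hlam hLam⟩,
    ⟨fun x hx => (analyticAt_propagatorHat hlam hLam hx).contDiffAt.contDiffWithinAt,
      fun n => ⟨fourierPairing_pow_mul_propagator hlam hLam n,
        (analyticAt_iteratedDeriv
          (analyticAt_propagatorHat hlam hLam h0) n).continuousAt.tendsto,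
        iteratedDeriv_propagatorHat_zero hlam n⟩⟩,
    (summable_residueB_div_pow hlam hLam 6).of_abs,
    firstCorrection_isBigO hlam hLam, tendsto_correctionConst⟩
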